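/- Let $d,g,c>0$ and $C,p_0\in\mathbb{R}$. Let $\eta\in C^3(\mathbb{R})$ be $2\pi$-periodic and even, with $\eta>-d$ and $\eta'<0$ on $(0,\pi)$; put $\Omega=\{(x,y):-d<y<\eta(x)\}$. Let $\gamma\in C^1([0,-p_0],\mathbb{R})$ and let $\psi\in C^2(\overline\Omega)$ be $2\pi$-periodic and even in $x$ and satisfy \[ \Delta\psi=-\gamma(\psi)\ \text{in }\Omega,\qquad |\nabla\psi|^2+2gy=C\ \text{and}\ \psi=0\ \text{on } y=\eta(x),\qquad \psi=-p_0\ \text{on } y=-d,\qquad \psi_y<0\ \text{in }\overline\Omega . \] Let $u=c+\psi_y$ and $v=-\psi_x$ be the horizontal and vertical velocity. Then $p_0<0$, and for every $p\in[p_0,0]$ the streamline $\{(x,y)\in\overline\Omega:\psi(x,y)=-p\}$ is the graph $y=\sigma_p(x)$ of a unique differentiable function $\sigma_p:\mathbb{R}\to\mathbb{R}$, with $\sigma_{p_0}=-d$ (the bed), $\sigma_0=\eta$ (the surface), and $\sigma_{p_1}<\sigma_{p_2}$ everywhere if $p_1<p_2$; for other $p$ the level set is empty. Moreover: (i) Every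 streamline other than the bed satisfies $\sigma_p'(x)<0$ for $x\in(0,\pi)$, and the maximal steepness $\max_{x\in\mathbb{R}}|\sigma_p'(x)|$ is strictly increasing from bottom to surface, i.e. strictly increasing in $p\in[p_0,0]$. (ii) If $\gamma'\ge 0$ and $\gamma\le 0$ on $[0,-p_0]$, then the maximal horizontal velocity $\max_{x\in\mathbb{R}}u(x,\sigma_p(x))$ is strictly increasing from bottom to surface. (iii) The vertical velocity satisfies $v(x,y)>0$ for all $x\in(0,\pi)$ and $-d<y\le\eta(x)$; and if $\gamma'\le 0$ on $[0,-p_0]$, then $\max_{x\in\mathbb{R}}|v(x,\sigma_p(x))|$ is strictly increasing from bottom to surface. All these maxima are attained. -/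

import Mathlib

/-- The open fluid domain between the flat bed `y = -d` and the free surface `y = η x`. -/
def fluidDomain (d : ℝ) (η : ℝ → ℝ) : Set (ℝ × ℝ) :=
  {z | -d < z.2 ∧ z.2 < η z.1}

/-- The closed fluid domain. It is the closure of `fluidDomain d η` when `η` is continuous and
the surface lies above the bed. -/
def closedFluidDomain (d : ℝ) (η : ℝ → ℝ) : Set (ℝ × ℝ) :=
  {z | -d ≤ z.2 ∧ z.2 ≤ η z.1}

/-- The partial derivative `∂f/∂x` relative to a set `K` (the ordinary one at interior points of
`K`, its one-sided counterpart at the boundary). -/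
noncomputable def partialX (K : Set (ℝ × ℝ)) (f : ℝ × ℝ → ℝ) (z : ℝ × ℝ) : ℝ :=
  fderivWithin ℝ f K z (1, 0)

/-- The partial derivative `∂f/∂y` relative to a set `K`. -/
noncomputable def partialY (K : Set (ℝ × ℝ)) (f : ℝ × ℝ → ℝ) (z : ℝ × ℝ) : ℝ :=
  fderivWithin ℝ f K z (0, 1)

/-- A steady symmetric gravity water wave of period `2π` over a flat bed, without stagnation:
surface profile `η`, stream function `ψ`, vorticity function `γ` on `[0, -p₀]`, relative mass
flux `p₀`, wave speed `c`, gravity `g`, energy constant `C`. -/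
structure IsSteadyWave (d g c C p₀ : ℝ) (γ η : ℝ → ℝ) (ψ : ℝ × ℝ → ℝ) : Prop where
  depth_pos : 0 < d
  gravity_pos : 0 < g
  speed_pos : 0 < c
  vorticity_smooth : ContDiffOn ℝ 1 γ (Set.Icc 0 (-p₀))
  surface_smooth : ContDiff ℝ 3 η
  surface_above_bed : ∀ x, -d < η x
  surface_periodic : ∀ x, η (x + 2 * Real.pi) = η x
  surface_even : ∀ x, η (-x) = η x
  surface_decreasing : ∀ x ∈ Set.Ioo 0 Real.pi, deriv η x < 0
  stream_smooth : ContDiffOn ℝ 2 ψ (closedFluidDomain d η)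
  stream_periodic : ∀ z ∈ closedFluidDomain d η, ψ (z.1 + 2 * Real.pi, z.2) = ψ z
  stream_even : ∀ z ∈ closedFluidDomain d η, ψ (-z.1, z.2) = ψ z
  /-- `Δψ = -γ(ψ)` in the fluid domain. -/
  stream_eq : ∀ z ∈ fluidDomain d η,
    partialX (closedFluidDomain d η) (partialX (closedFluidDomain d η) ψ) z
      + partialY (closedFluidDomain d η) (partialY (closedFluidDomain d η) ψ) z = -γ (ψ z)
  /-- Bernoulli's law `|∇ψ|² + 2 g y = C` on the free surface. -/
  bernoulli : ∀ x,
    (partialX (closedFluidDomain d η) ψ (x, η x)) ^ 2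
      + (partialY (closedFluidDomain d η) ψ (x, η x)) ^ 2 + 2 * g * η x = C
  stream_surface : ∀ x, ψ (x, η x) = 0
  stream_bed : ∀ x, ψ (x, -d) = -p₀
  /-- No stagnation: `ψ_y < 0` in the closed fluid domain. -/
  no_stagnation : ∀ z ∈ closedFluidDomain d η, partialY (closedFluidDomain d η) ψ z < 0

/-- The horizontal velocity `u = c + ψ_y`. -/
noncomputable def horizontalVelocity (d c : ℝ) (η : ℝ → ℝ) (ψ : ℝ × ℝ → ℝ) (z : ℝ × ℝ) : ℝ :=
  c + partialY (closedFluidDomain d η) ψ z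

/-- The vertical velocity `v = -ψ_x`. -/
noncomputable def verticalVelocity (d : ℝ) (η : ℝ → ℝ) (ψ : ℝ × ℝ → ℝ) (z : ℝ × ℝ) : ℝ :=
  -partialX (closedFluidDomain d η) ψ z

/-- The level set `{ψ = -p}` in the closed fluid domain is the graph of `σ`. -/
def IsStreamline (d : ℝ) (η : ℝ → ℝ) (ψ : ℝ × ℝ → ℝ) (p : ℝ) (σ : ℝ → ℝ) : Prop :=
  ∀ z : ℝ × ℝ, (z ∈ closedFluidDomain d η ∧ ψ z = -p) ↔ z.2 = σ z.1

/-- For a quantity `F σ x` defined along streamlines `(x, σ x)`, the maximum over `x ∈ ℝ` is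
attained on each streamline and strictly increases from the bed (`p = p₀`) to the surface
(`p = 0`). -/
def MaxStrictlyIncreasesUpwards (d p₀ : ℝ) (η : ℝ → ℝ) (ψ : ℝ × ℝ → ℝ)
    (F : (ℝ → ℝ) → ℝ → ℝ) : Prop :=
  ∃ M : ℝ → ℝ,
    (∀ p ∈ Set.Icc p₀ 0, ∀ σ : ℝ → ℝ, IsStreamline d η ψ p σ →
      IsGreatest (Set.range (F σ)) (M p)) ∧
    StrictMonoOn M (Set.Icc p₀ 0)

/-!
The derivatives of the stream function satisfy the linearised equation `Δf = -γ'(ψ) f`, and all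
three monotonicity statements are strong maximum principles for it, in the region below a
streamline.

*Regularity.* As `ψ` is only `C²`, a derivative `f = a ψ_x + b ψ_y` is only `C¹`, and the equation
holds in the weak sense. Elliptic regularity is avoided as follows. With `G = Δψ = -γ(ψ)`, which is
`C¹`, and `g = b ψ_x - a ψ_y`, one has `f_x = a G + g_y` and `f_y = b G - g_x`. Hence the mean
`A(r)` of `f` over a circle of radius `r` satisfies `A' = B`, where `B` is the mean of
`G (a, b) · n`, and `(r B)' = r · mean (a G_x + b G_y)`: the part of `∇f` coming from `g` is a tangential derivative
and integrates to zero. If `f ≥ 0`, `a G_x + b G_y ≤ K f` and `f` vanishes at the centre, a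
Grönwall argument gives `A = 0` for small radii, so that `f` vanishes nearby. This is
`eq_zero_of_cauchyRiemann`, specialised to water waves in `IsSteadyWave.eq_zero_of_nonneg`.

*Reduction.* If a continuous quantity that is even and periodic in `x` has no maximum strictly below
a streamline, over the region below it, then its maximum along streamlines is strictly increasing
(`maxStrictlyIncreasesUpwards_of_maximum_principle`).

*The three quantities.* The slope of a streamline is `-ψ_x / ψ_y`. Since `ψ_y < 0` solves the same
linear equation as `ψ_x`, a bound `m` for the slope is a sign condition on the solution
`ψ_x ± m ψ_y`, and the strong maximum principle applies whatever the sign of `γ'`. On the crest and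
trough lines and on the bed `ψ_x = 0`, and `ψ_x < 0` on the surface; this gives `ψ_x < 0` in the
whole half period (`partialX_neg`) and the statement on steepness (`slope_not_max`). If `γ' ≤ 0`,
then `-ψ_x` is subharmonic where it is positive (`abs_partialX_not_max`). If `γ' ≥ 0`, then `ψ_y` is
subharmonic; a maximum on the bed would, by comparison with a linear function of `y` in a strip,
make `ψ_yy` negative there, but `ψ_yy = -γ ≥ 0` on the bed (`partialY_not_max`).
-/

open Set Filter Topology Metric

/-! ### The strong maximum principle for generalised Cauchy–Riemann systems -/

/-- The point at angle `θ` on the Euclidean circle of radius `r` about `z`. -/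
noncomputable def circlePoint (z : ℝ × ℝ) (r θ : ℝ) : ℝ × ℝ :=
  (z.1 + r * Real.cos θ, z.2 + r * Real.sin θ)

/-- The circle of radius `r` lies in the closed ball of radius `R`; the product `ℝ × ℝ` carries
the sup norm. -/
lemma circlePoint_mem_closedBall {z : ℝ × ℝ} {r R : ℝ} (hr : |r| ≤ R) (θ : ℝ) :
    circlePoint z r θ ∈ closedBall z R := by
  have h1 : |r * Real.cos θ| ≤ R := by
    rw [abs_mul]
    nlinarith [Real.abs_cos_le_one θ, abs_nonneg r, abs_nonneg (Real.cos θ)]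
  have h2 : |r * Real.sin θ| ≤ R := by
    rw [abs_mul]
    nlinarith [Real.abs_sin_le_one θ, abs_nonneg r, abs_nonneg (Real.sin θ)]
  rw [mem_closedBall, Prod.dist_eq, Real.dist_eq, Real.dist_eq]
  simpa only [circlePoint, add_sub_cancel_left, max_le_iff] using ⟨h1, h2⟩

lemma continuous_circlePoint (z : ℝ × ℝ) (r : ℝ) : Continuous (circlePoint z r) := by
  unfold circlePoint; fun_prop

lemma hasDerivAt_circlePoint_radius (z : ℝ × ℝ) (r θ : ℝ) :
    HasDerivAt (fun r => circlePoint z r θ) (Real.cos θ, Real.sin θ) r := by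
  unfold circlePoint
  refine HasDerivAt.prodMk ?_ ?_
  · simpa using ((hasDerivAt_id r).mul_const (Real.cos θ)).const_add z.1
  · simpa using ((hasDerivAt_id r).mul_const (Real.sin θ)).const_add z.2

lemma hasDerivAt_circlePoint_angle (z : ℝ × ℝ) (r θ : ℝ) :
    HasDerivAt (circlePoint z r) (-(r * Real.sin θ), r * Real.cos θ) θ := by
  unfold circlePoint
  refine HasDerivAt.prodMk ?_ ?_
  · simpa using ((Real.hasDerivAt_cos θ).const_mul r).const_add z.1
  · simpa using ((Real.hasDerivAt_sin θ).const_mul r).const_add z.2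

lemma clm_prod_apply (L : ℝ × ℝ →L[ℝ] ℝ) (a b : ℝ) : L (a, b) = a * L (1, 0) + b * L (0, 1) := by
  have : ((a, b) : ℝ × ℝ) = a • (1, 0) + b • (0, 1) := by simp
  rw [this, map_add, map_smul, map_smul]; simp

section Circle

variable {U : Set (ℝ × ℝ)} {z : ℝ × ℝ} {R : ℝ}

lemma continuous_comp_circlePoint {F : Type*} [TopologicalSpace F] {H : ℝ × ℝ → F}
    (hH : ContinuousOn H U) (hR : closedBall z R ⊆ U) {r : ℝ} (hr : |r| ≤ R) :
    Continuous fun θ => H (circlePoint z r θ) :=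
  hH.comp_continuous (continuous_circlePoint z r) fun θ => hR (circlePoint_mem_closedBall hr θ)

/-- Differentiation of a circle integral with respect to the radius. -/
lemma hasDerivAt_integral_circlePoint {H : ℝ × ℝ → ℝ} {k : ℝ → ℝ} (hU : IsOpen U)
    (hH : ContDiffOn ℝ 1 H U) (hR : closedBall z R ⊆ U) (hk : Continuous k) {r : ℝ}
    (hr : |r| < R) :
    HasDerivAt (fun r => ∫ θ in -Real.pi..Real.pi, H (circlePoint z r θ) * k θ)
      (∫ θ in -Real.pi..Real.pi, (Real.cos θ * fderiv ℝ H (circlePoint z r θ) (1, 0)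
        + Real.sin θ * fderiv ℝ H (circlePoint z r θ) (0, 1)) * k θ) r := by
  have hD : ContinuousOn (fderiv ℝ H) U := hH.continuousOn_fderiv_of_isOpen hU le_rfl
  obtain ⟨B, hB⟩ := (isCompact_closedBall z R).exists_bound_of_continuousOn (hD.mono hR)
  have hev : ∀ᶠ s in 𝓝 r, |s| < R := (continuous_abs.tendsto r).eventually_lt_const hr
  have hB0 : 0 ≤ B := (norm_nonneg _).trans (hB _ (circlePoint_mem_closedBall hr.le 0))
  have key := intervalIntegral.hasDerivAt_integral_of_dominated_loc_of_deriv_le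
    (μ := MeasureTheory.volume) (a := -Real.pi) (b := Real.pi)
    (F := fun r θ => H (circlePoint z r θ) * k θ)
    (F' := fun r θ => fderiv ℝ H (circlePoint z r θ) (Real.cos θ, Real.sin θ) * k θ)
    (x₀ := r) (s := {s | |s| < R}) (bound := fun θ => B * |k θ|) hev ?_ ?_ ?_ ?_ ?_ ?_
  · refine key.2.congr_deriv (intervalIntegral.integral_congr fun θ _ => ?_)
    rw [clm_prod_apply]
  · filter_upwards [hev] with s hs
    exact ((continuous_comp_circlePoint hH.continuousOn hR hs.le).mul hk).aestronglyMeasurable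
  · exact ((continuous_comp_circlePoint hH.continuousOn hR hr.le).mul hk).intervalIntegrable _ _
  · have h1 := continuous_comp_circlePoint hD hR hr.le
    exact ((h1.clm_apply (Real.continuous_cos.prodMk Real.continuous_sin)).mul
      hk).aestronglyMeasurable
  · refine Eventually.of_forall fun θ _ s hs => ?_
    rw [norm_mul, Real.norm_eq_abs (k θ)]
    refine mul_le_mul_of_nonneg_right ?_ (abs_nonneg _)
    refine ((fderiv ℝ H (circlePoint z s θ)).le_opNorm _).trans ?_
    have h1 : ‖((Real.cos θ, Real.sin θ) : ℝ × ℝ)‖ ≤ 1 := by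
      simp [Prod.norm_def, Real.abs_cos_le_one, Real.abs_sin_le_one]
    calc _ ≤ B * 1 := mul_le_mul (hB _ (circlePoint_mem_closedBall hs.le θ)) h1
            (norm_nonneg _) hB0
      _ = B := mul_one B
  · exact (continuous_const.mul hk.abs).intervalIntegrable _ _
  · refine Eventually.of_forall fun θ _ s hs => ?_
    have h1 : DifferentiableAt ℝ H (circlePoint z s θ) :=
      (hH.contDiffAt (hU.mem_nhds (hR (circlePoint_mem_closedBall hs.le θ)))).differentiableAt
        one_ne_zero
    exact (h1.hasFDerivAt.comp_hasDerivAt s (hasDerivAt_circlePoint_radius z s θ)).mul_const (k θ)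

lemma hasDerivAt_comp_circlePoint {H : ℝ × ℝ → ℝ} (hU : IsOpen U)
    (hH : ContDiffOn ℝ 1 H U) (hR : closedBall z R ⊆ U) {r : ℝ} (hr : |r| ≤ R) (θ : ℝ) :
    HasDerivAt (fun θ => H (circlePoint z r θ))
      (r * (Real.cos θ * fderiv ℝ H (circlePoint z r θ) (0, 1)
        - Real.sin θ * fderiv ℝ H (circlePoint z r θ) (1, 0))) θ := by
  have h1 : DifferentiableAt ℝ H (circlePoint z r θ) :=
    (hH.contDiffAt (hU.mem_nhds (hR (circlePoint_mem_closedBall hr θ)))).differentiableAt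
      one_ne_zero
  refine (h1.hasFDerivAt.comp_hasDerivAt θ (hasDerivAt_circlePoint_angle z r θ)).congr_deriv ?_
  rw [clm_prod_apply]; ring

lemma continuous_fderiv_circlePoint {H : ℝ × ℝ → ℝ} (hU : IsOpen U)
    (hH : ContDiffOn ℝ 1 H U) (hR : closedBall z R ⊆ U) {r : ℝ} (hr : |r| ≤ R) (v : ℝ × ℝ) :
    Continuous fun θ => fderiv ℝ H (circlePoint z r θ) v :=
  (continuous_comp_circlePoint (hH.continuousOn_fderiv_of_isOpen hU le_rfl) hR hr).clm_apply
    continuous_const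

/-- Integration by parts along a circle: the tangential derivative of `H` is paired with a
`2π`-periodic function `m`. -/
lemma integral_circlePoint_by_parts {H : ℝ × ℝ → ℝ} {m m' : ℝ → ℝ} (hU : IsOpen U)
    (hH : ContDiffOn ℝ 1 H U) (hR : closedBall z R ⊆ U) {r : ℝ} (hr : |r| ≤ R)
    (hm : ∀ θ, HasDerivAt m (m' θ) θ) (hm' : Continuous m') (hper : m Real.pi = m (-Real.pi)) :
    ∫ θ in -Real.pi..Real.pi, H (circlePoint z r θ) * m' θ
      = -∫ θ in -Real.pi..Real.pi, (r * (Real.cos θ * fderiv ℝ H (circlePoint z r θ) (0, 1)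
        - Real.sin θ * fderiv ℝ H (circlePoint z r θ) (1, 0))) * m θ := by
  rw [intervalIntegral.integral_mul_deriv_eq_deriv_mul
    (fun θ _ => hasDerivAt_comp_circlePoint hU hH hR hr θ) (fun θ _ => hm θ) _
    (hm'.intervalIntegrable _ _)]
  · have : circlePoint z r Real.pi = circlePoint z r (-Real.pi) := by simp [circlePoint]
    rw [this, hper]; ring
  · have h1 := continuous_fderiv_circlePoint hU hH hR hr (1, 0)
    have h2 := continuous_fderiv_circlePoint hU hH hR hr (0, 1)
    exact Continuous.intervalIntegrable (by fun_prop) _ _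

/-- The radial derivative of the circle means of `f` only involves `G`: the part of `∇f` that is a
rotated gradient `∇g` contributes a tangential derivative, with zero integral. -/
lemma hasDerivAt_circle_integral_of_cauchyRiemann {f g G : ℝ × ℝ → ℝ} {a b : ℝ} (hU : IsOpen U)
    (hf : ContDiffOn ℝ 1 f U) (hg : ContDiffOn ℝ 1 g U) (hG : ContDiffOn ℝ 1 G U)
    (hx : ∀ w ∈ U, fderiv ℝ f w (1, 0) = a * G w + fderiv ℝ g w (0, 1))
    (hy : ∀ w ∈ U, fderiv ℝ f w (0, 1) = b * G w - fderiv ℝ g w (1, 0))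
    (hR : closedBall z R ⊆ U) {r : ℝ} (hr : |r| < R) (hr0 : r ≠ 0) :
    HasDerivAt (fun r => ∫ θ in -Real.pi..Real.pi, f (circlePoint z r θ))
      (∫ θ in -Real.pi..Real.pi, G (circlePoint z r θ) * (a * Real.cos θ + b * Real.sin θ)) r := by
  have h := hasDerivAt_integral_circlePoint (k := fun _ => 1) hU hf hR continuous_const hr
  simp only [mul_one] at h
  refine h.congr_deriv ?_
  have hgx := continuous_fderiv_circlePoint hU hg hR hr.le (1, 0)
  have hgy := continuous_fderiv_circlePoint hU hg hR hr.le (0, 1)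
  have hGc := continuous_comp_circlePoint hG.continuousOn hR hr.le
  have hz : ∫ θ in -Real.pi..Real.pi, (r * (Real.cos θ * fderiv ℝ g (circlePoint z r θ) (0, 1)
        - Real.sin θ * fderiv ℝ g (circlePoint z r θ) (1, 0))) = 0 := by
    have := integral_circlePoint_by_parts (m := fun _ => 1) (m' := fun _ => 0) hU hg hR hr.le
      (fun θ => hasDerivAt_const _ _) continuous_const rfl
    simpa using this
  rw [intervalIntegral.integral_const_mul] at hz
  have hz' := (mul_eq_zero.1 hz).resolve_left hr0
  have hsum := intervalIntegral.integral_add (μ := MeasureTheory.volume)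
    ((hGc.mul (by fun_prop :
      Continuous fun θ => a * Real.cos θ + b * Real.sin θ)).intervalIntegrable (-Real.pi) Real.pi)
    ((by fun_prop : Continuous fun θ => Real.cos θ * fderiv ℝ g (circlePoint z r θ) (0, 1)
      - Real.sin θ * fderiv ℝ g (circlePoint z r θ) (1, 0)).intervalIntegrable (-Real.pi) Real.pi)
  rw [hz', add_zero] at hsum
  refine Eq.trans ?_ hsum
  refine intervalIntegral.integral_congr fun θ _ => ?_
  have hw := hR (circlePoint_mem_closedBall hr.le θ (z := z))
  simp only [Pi.mul_apply]
  rw [hx _ hw, hy _ hw]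
  ring

/-- The divergence theorem on discs for the field `G • (a, b)`, in differentiated form. -/
lemma hasDerivAt_mul_circle_flux {G : ℝ × ℝ → ℝ} {a b : ℝ} (hU : IsOpen U)
    (hG : ContDiffOn ℝ 1 G U) (hR : closedBall z R ⊆ U) {r : ℝ} (hr : |r| < R) :
    HasDerivAt (fun r => r * ∫ θ in -Real.pi..Real.pi,
        G (circlePoint z r θ) * (a * Real.cos θ + b * Real.sin θ))
      (r * ∫ θ in -Real.pi..Real.pi, (a * fderiv ℝ G (circlePoint z r θ) (1, 0)
        + b * fderiv ℝ G (circlePoint z r θ) (0, 1))) r := by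
  have hk : Continuous fun θ => a * Real.cos θ + b * Real.sin θ := by fun_prop
  have h := (hasDerivAt_id r).mul (hasDerivAt_integral_circlePoint hU hG hR hk hr)
  refine h.congr_deriv ?_
  have hGx := continuous_fderiv_circlePoint hU hG hR hr.le (1, 0)
  have hGy := continuous_fderiv_circlePoint hU hG hR hr.le (0, 1)
  have hm : ∀ θ, HasDerivAt (fun θ => a * Real.sin θ - b * Real.cos θ)
      (a * Real.cos θ + b * Real.sin θ) θ := fun θ => by
    refine (((Real.hasDerivAt_sin θ).const_mul a).sub
      ((Real.hasDerivAt_cos θ).const_mul b)).congr_deriv ?_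
    ring
  rw [one_mul, integral_circlePoint_by_parts hU hG hR hr.le hm hk (by simp)]
  rw [id, ← intervalIntegral.integral_const_mul, ← intervalIntegral.integral_const_mul,
    ← intervalIntegral.integral_neg, ← intervalIntegral.integral_add
    (Continuous.intervalIntegrable (by fun_prop) _ _)
    (Continuous.intervalIntegrable (by fun_prop) _ _)]
  refine intervalIntegral.integral_congr fun θ _ => ?_
  have hsc := Real.sin_sq_add_cos_sq θ
  linear_combination (a * r * fderiv ℝ G (circlePoint z r θ) (1, 0)
    + b * r * fderiv ℝ G (circlePoint z r θ) (0, 1)) * hsc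

end Circle

/-- A Grönwall-type uniqueness statement for `A'' + A' / r ≤ K * A`, in first order form. -/
lemma eqOn_zero_of_radial_ineq {A B D : ℝ → ℝ} {R K : ℝ} (hR : 0 < R) (hK : K * R ^ 2 < 4)
    (hK0 : 0 ≤ K)
    (hAc : ContinuousOn A (Icc 0 R)) (hA0 : A 0 = 0) (hApos : ∀ r ∈ Icc 0 R, 0 ≤ A r)
    (hA : ∀ r ∈ Ioo 0 R, HasDerivAt A (B r) r)
    (hBc : ContinuousOn (fun r => r * B r) (Icc 0 R))
    (hB : ∀ r ∈ Ioo 0 R, HasDerivAt (fun r => r * B r) (r * D r) r)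
    (hD : ∀ r ∈ Ioo 0 R, D r ≤ K * A r) : ∀ r ∈ Icc 0 R, A r = 0 := by
  obtain ⟨s, hs, hmax⟩ := isCompact_Icc.exists_isMaxOn (nonempty_Icc.2 hR.le) hAc
  set S := A s with hS
  have hle : ∀ r ∈ Icc 0 R, A r ≤ S := fun r hr => hmax hr
  have hS0 : 0 ≤ S := hApos s hs
  have hBle : ∀ r ∈ Ioo 0 R, B r ≤ K * S * r / 2 := by
    have hmono : MonotoneOn (fun r => K * S * r ^ 2 / 2 - r * B r) (Icc 0 R) := by
      have hd : ∀ r ∈ Ioo 0 R, HasDerivAt (fun r => K * S * r ^ 2 / 2 - r * B r)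
          (K * S * r - r * D r) r := fun r hr => by
        refine HasDerivAt.sub ?_ (hB r hr)
        refine (((hasDerivAt_pow 2 r).const_mul (K * S)).div_const 2).congr_deriv ?_
        push_cast; ring
      refine monotoneOn_of_deriv_nonneg (convex_Icc _ _) (by fun_prop) ?_ ?_
      · rw [interior_Icc]
        exact fun r hr => (hd r hr).differentiableAt.differentiableWithinAt
      · rw [interior_Icc]
        intro r hr
        rw [(hd r hr).deriv]
        have h1 := hD r hr
        have h2 := mul_le_mul_of_nonneg_left (hle r (Ioo_subset_Icc_self hr)) hK0
        nlinarith [hr.1]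
    intro r hr
    have := hmono (left_mem_Icc.2 hR.le) (Ioo_subset_Icc_self hr) hr.1.le
    simp only at this
    have h3 : r * B r ≤ r * (K * S * r / 2) := by nlinarith
    exact le_of_mul_le_mul_left h3 hr.1
  have hAle : ∀ r ∈ Icc 0 R, A r ≤ K * S * r ^ 2 / 4 := by
    have hmono : MonotoneOn (fun r => K * S * r ^ 2 / 4 - A r) (Icc 0 R) := by
      have hd : ∀ r ∈ Ioo 0 R, HasDerivAt (fun r => K * S * r ^ 2 / 4 - A r)
          (K * S * r / 2 - B r) r := fun r hr => by
        refine HasDerivAt.sub ?_ (hA r hr)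
        refine (((hasDerivAt_pow 2 r).const_mul (K * S)).div_const 4).congr_deriv ?_
        push_cast; ring
      refine monotoneOn_of_deriv_nonneg (convex_Icc _ _) (by fun_prop) ?_ ?_
      · rw [interior_Icc]
        exact fun r hr => (hd r hr).differentiableAt.differentiableWithinAt
      · rw [interior_Icc]
        intro r hr
        rw [(hd r hr).deriv]
        linarith [hBle r hr]
    intro r hr
    have := hmono (left_mem_Icc.2 hR.le) hr hr.1
    simp only [hA0] at this
    linarith
  have hSz : S ≤ 0 := by
    have h1 := hAle s hs
    have h2 : K * s ^ 2 ≤ K * R ^ 2 :=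
      mul_le_mul_of_nonneg_left (pow_le_pow_left₀ hs.1 hs.2 2) hK0
    by_contra hneg
    push Not at hneg
    nlinarith
  exact fun r hr => le_antisymm ((hle r hr).trans hSz) (hApos r hr)

lemma exists_circlePoint_eq (z w : ℝ × ℝ) :
    ∃ r θ : ℝ, 0 ≤ r ∧ r ≤ 2 * dist w z ∧ θ ∈ Icc (-Real.pi) Real.pi ∧ circlePoint z r θ = w := by
  set ζ : ℂ := ⟨w.1 - z.1, w.2 - z.2⟩ with hζ
  refine ⟨‖ζ‖, ζ.arg, norm_nonneg _, ?_, ⟨(Complex.neg_pi_lt_arg ζ).le, Complex.arg_le_pi ζ⟩, ?_⟩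
  · refine (Complex.norm_le_abs_re_add_abs_im ζ).trans ?_
    have h1 : |w.1 - z.1| ≤ dist w z := by
      rw [← Real.dist_eq, Prod.dist_eq]; exact le_max_left _ _
    have h2 : |w.2 - z.2| ≤ dist w z := by
      rw [← Real.dist_eq, Prod.dist_eq]; exact le_max_right _ _
    simp only [hζ]; linarith
  · ext <;> simp [circlePoint, Complex.norm_mul_cos_arg, Complex.norm_mul_sin_arg, hζ]

/-- Local form of the strong maximum principle. -/
lemma eventually_eq_zero_of_cauchyRiemann {f g G : ℝ × ℝ → ℝ} {a b K : ℝ} {U : Set (ℝ × ℝ)}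
    (hU : IsOpen U)
    (hf : ContDiffOn ℝ 1 f U) (hg : ContDiffOn ℝ 1 g U) (hG : ContDiffOn ℝ 1 G U)
    (hx : ∀ w ∈ U, fderiv ℝ f w (1, 0) = a * G w + fderiv ℝ g w (0, 1))
    (hy : ∀ w ∈ U, fderiv ℝ f w (0, 1) = b * G w - fderiv ℝ g w (1, 0))
    (hpos : ∀ w ∈ U, 0 ≤ f w)
    (hK : ∀ w ∈ U, a * fderiv ℝ G w (1, 0) + b * fderiv ℝ G w (0, 1) ≤ K * f w)
    {z : ℝ × ℝ} (hz : z ∈ U) (hfz : f z = 0) : ∀ᶠ w in 𝓝 z, f w = 0 := by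
  wlog hK0 : 0 ≤ K generalizing K
  · refine this (K := 0) (fun w hw => ?_) le_rfl
    have := hK w hw
    nlinarith [hpos w hw]
  obtain ⟨R', hR', hball⟩ := nhds_basis_closedBall.mem_iff.1 (hU.mem_nhds hz)
  -- a smaller radius, for which the Grönwall argument contracts
  obtain ⟨R, hR, hRR', hRK⟩ : ∃ R : ℝ, 0 < R ∧ R < R' ∧ K * R ^ 2 < 4 := by
    have h1 : ∀ᶠ R : ℝ in 𝓝[>] 0, K * R ^ 2 < 4 := by
      have : Tendsto (fun R : ℝ => K * R ^ 2) (𝓝[>] 0) (𝓝 0) := by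
        have : Continuous fun R : ℝ => K * R ^ 2 := by fun_prop
        simpa using (this.tendsto 0).mono_left nhdsWithin_le_nhds
      exact this.eventually_lt_const (by norm_num)
    have h2 : ∀ᶠ R : ℝ in 𝓝[>] 0, R ∈ Ioo 0 R' := Ioo_mem_nhdsGT hR'
    obtain ⟨R, h1, h2⟩ := (h1.and h2).exists
    exact ⟨R, h2.1, h2.2, h1⟩
  have habs : ∀ r ∈ Icc 0 R, |r| < R' := fun r hr => by
    rw [abs_of_nonneg hr.1]; exact hr.2.trans_lt hRR'
  have hA := eqOn_zero_of_radial_ineq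
    (A := fun r => ∫ θ in -Real.pi..Real.pi, f (circlePoint z r θ))
    (B := fun r => ∫ θ in -Real.pi..Real.pi,
      G (circlePoint z r θ) * (a * Real.cos θ + b * Real.sin θ))
    (D := fun r => ∫ θ in -Real.pi..Real.pi, (a * fderiv ℝ G (circlePoint z r θ) (1, 0)
        + b * fderiv ℝ G (circlePoint z r θ) (0, 1))) hR hRK hK0 ?_ ?_ ?_ ?_ ?_ ?_ ?_
  · have hzero : ∀ r ∈ Icc 0 R, ∀ θ ∈ Icc (-Real.pi) Real.pi, f (circlePoint z r θ) = 0 := by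
      intro r hr θ hθ
      have hmem : ∀ θ, circlePoint z r θ ∈ U := fun θ =>
        hball (circlePoint_mem_closedBall (habs r hr).le θ)
      by_contra hne
      have := intervalIntegral.integral_pos (f := fun θ => f (circlePoint z r θ))
        (by linarith [Real.pi_pos] : -Real.pi < Real.pi)
        (continuous_comp_circlePoint hf.continuousOn hball (habs r hr).le).continuousOn
        (fun θ _ => hpos _ (hmem θ)) ⟨θ, hθ, (hpos _ (hmem θ)).lt_of_ne' hne⟩
      exact this.ne' (hA r hr)
    filter_upwards [Metric.ball_mem_nhds z (half_pos hR)] with w hw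
    obtain ⟨r, θ, hr0, hr, hθ, rfl⟩ := exists_circlePoint_eq z w
    rw [Metric.mem_ball] at hw
    exact hzero r ⟨hr0, by linarith⟩ θ hθ
  · intro r hr
    have := hasDerivAt_integral_circlePoint (k := fun _ => 1) hU hf hball continuous_const
      (habs r hr)
    simp only [mul_one] at this
    exact this.continuousAt.continuousWithinAt
  · simp [circlePoint, hfz]
  · intro r hr
    exact intervalIntegral.integral_nonneg (by linarith [Real.pi_pos]) fun θ _ =>
      hpos _ (hball (circlePoint_mem_closedBall (habs r hr).le θ))
  · exact fun r hr => hasDerivAt_circle_integral_of_cauchyRiemann hU hf hg hG hx hy hball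
      (habs r (Ioo_subset_Icc_self hr)) hr.1.ne'
  · exact fun r hr => (hasDerivAt_mul_circle_flux hU hG hball
      (habs r hr)).continuousAt.continuousWithinAt
  · exact fun r hr => hasDerivAt_mul_circle_flux hU hG hball (habs r (Ioo_subset_Icc_self hr))
  · intro r hr
    have hr' := (habs r (Ioo_subset_Icc_self hr)).le
    have h1 := continuous_fderiv_circlePoint hU hG hball hr' (1, 0)
    have h2 := continuous_fderiv_circlePoint hU hG hball hr' (0, 1)
    have h3 := continuous_comp_circlePoint hf.continuousOn hball hr'
    rw [← intervalIntegral.integral_const_mul]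
    exact intervalIntegral.integral_mono_on (by linarith [Real.pi_pos])
      (Continuous.intervalIntegrable (by fun_prop) _ _)
      ((continuous_const.mul h3).intervalIntegrable _ _)
      fun θ _ => hK _ (hball (circlePoint_mem_closedBall hr' θ))

/-- Strong maximum principle. If `f` and `g` satisfy the generalised Cauchy–Riemann system
`f_x = a G + g_y`, `f_y = b G - g_x`, then `Δf = a G_x + b G_y` in the weak sense, although `f` is
only assumed to be `C¹`. A nonnegative `f` with `Δf ≤ K f` on a connected open set vanishes
identically as soon as it vanishes at one point. -/
theorem eq_zero_of_cauchyRiemann {f g G : ℝ × ℝ → ℝ} {a b K : ℝ} {U : Set (ℝ × ℝ)}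
    (hU : IsOpen U) (hUc : IsPreconnected U)
    (hf : ContDiffOn ℝ 1 f U) (hg : ContDiffOn ℝ 1 g U) (hG : ContDiffOn ℝ 1 G U)
    (hx : ∀ w ∈ U, fderiv ℝ f w (1, 0) = a * G w + fderiv ℝ g w (0, 1))
    (hy : ∀ w ∈ U, fderiv ℝ f w (0, 1) = b * G w - fderiv ℝ g w (1, 0))
    (hpos : ∀ w ∈ U, 0 ≤ f w)
    (hK : ∀ w ∈ U, a * fderiv ℝ G w (1, 0) + b * fderiv ℝ G w (0, 1) ≤ K * f w)
    {z : ℝ × ℝ} (hz : z ∈ U) (hfz : f z = 0) : ∀ w ∈ U, f w = 0 := by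
  have hsub : U ⊆ {w | ∀ᶠ w' in 𝓝 w, f w' = 0} := by
    refine hUc.subset_of_closure_inter_subset isOpen_setOfPred_eventually_nhds
      ⟨z, hz, eventually_eq_zero_of_cauchyRiemann hU hf hg hG hx hy hpos hK hz hfz⟩ ?_
    rintro w ⟨hw, hwU⟩
    refine eventually_eq_zero_of_cauchyRiemann hU hf hg hG hx hy hpos hK hwU ?_
    by_contra hne
    have h1 : ∀ᶠ w' in 𝓝 w, f w' ≠ 0 :=
      (hf.continuousOn.continuousAt (hU.mem_nhds hwU)).eventually_ne hne
    obtain ⟨w', hw', hw''⟩ := (mem_closure_iff_frequently.1 hw).and_eventually h1 |>.exists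
    exact hw'' hw'.self_of_nhds
  exact fun w hw => (hsub hw).self_of_nhds

/-! ### Regions between the bed and a graph -/

/-- The points over `I` strictly between the bed `y = -d` and the graph of `τ`. -/
def openRegion (d : ℝ) (I : Set ℝ) (τ : ℝ → ℝ) : Set (ℝ × ℝ) :=
  {z | z.1 ∈ I ∧ -d < z.2 ∧ z.2 < τ z.1}

/-- The points over `I` between the bed `y = -d` and the graph of `τ`, both included. -/
def closedRegion (d : ℝ) (I : Set ℝ) (τ : ℝ → ℝ) : Set (ℝ × ℝ) :=
  {z | z.1 ∈ I ∧ -d ≤ z.2 ∧ z.2 ≤ τ z.1}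

/-- The map that stretches the strip `0 ≤ t ≤ 1` vertically onto the region below the graph
of `τ`. -/
def stretch (d : ℝ) (τ : ℝ → ℝ) (w : ℝ × ℝ) : ℝ × ℝ :=
  (w.1, -d + w.2 * (τ w.1 + d))

section Region

variable {d : ℝ} {τ : ℝ → ℝ} {I J : Set ℝ}

lemma stretch_image_Icc (hτ : ∀ x, -d < τ x) :
    stretch d τ '' (I ×ˢ Icc 0 1) = closedRegion d I τ := by
  ext ⟨x, y⟩
  have h := hτ x
  have h0 : 0 < τ x + d := by linarith
  constructor
  · rintro ⟨⟨x', t⟩, ⟨hx, ht⟩, heq⟩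
    simp only [stretch, Prod.mk.injEq] at heq hx ht
    obtain ⟨rfl, rfl⟩ := heq
    refine ⟨hx, ?_, ?_⟩ <;> simp only <;> nlinarith [ht.1, ht.2]
  · rintro ⟨hx, h1, h2⟩
    simp only at hx h1 h2
    refine ⟨(x, (y + d) / (τ x + d)), ⟨hx, div_nonneg (by linarith) h0.le,
      (div_le_one h0).2 (by linarith)⟩, ?_⟩
    simp only [stretch, Prod.mk.injEq, true_and]
    field_simp
    ring

lemma stretch_image_Ioo (hτ : ∀ x, -d < τ x) :
    stretch d τ '' (I ×ˢ Ioo 0 1) = openRegion d I τ := by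
  ext ⟨x, y⟩
  have h := hτ x
  have h0 : 0 < τ x + d := by linarith
  constructor
  · rintro ⟨⟨x', t⟩, ⟨hx, ht⟩, heq⟩
    simp only [stretch, Prod.mk.injEq] at heq hx ht
    obtain ⟨rfl, rfl⟩ := heq
    refine ⟨hx, ?_, ?_⟩ <;> simp only <;> nlinarith [ht.1, ht.2]
  · rintro ⟨hx, h1, h2⟩
    simp only at hx h1 h2
    refine ⟨(x, (y + d) / (τ x + d)), ⟨hx, div_pos (by linarith) h0,
      (div_lt_one h0).2 (by linarith)⟩, ?_⟩
    simp only [stretch, Prod.mk.injEq, true_and]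
    field_simp
    ring

lemma continuous_stretch (hτc : Continuous τ) : Continuous (stretch d τ) := by
  unfold stretch; fun_prop

lemma isOpen_openRegion (hτc : Continuous τ) (hI : IsOpen I) : IsOpen (openRegion d I τ) :=
  (hI.preimage continuous_fst).inter ((isOpen_lt continuous_const continuous_snd).inter
    (isOpen_lt continuous_snd (hτc.comp continuous_fst)))

lemma isPreconnected_openRegion (hτc : Continuous τ) (hτ : ∀ x, -d < τ x)
    (hI : IsPreconnected I) : IsPreconnected (openRegion d I τ) := by
  rw [← stretch_image_Ioo hτ]
  exact (hI.prod isPreconnected_Ioo).image _ (continuous_stretch hτc).continuousOn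

lemma isCompact_closedRegion (hτc : Continuous τ) (hτ : ∀ x, -d < τ x) (hI : IsCompact I) :
    IsCompact (closedRegion d I τ) := by
  rw [← stretch_image_Icc hτ]
  exact (hI.prod isCompact_Icc).image (continuous_stretch hτc)

lemma closedRegion_subset_closure (hτc : Continuous τ) (hτ : ∀ x, -d < τ x)
    (hIJ : I ⊆ closure J) : closedRegion d I τ ⊆ closure (openRegion d J τ) := by
  rw [← stretch_image_Icc hτ, ← stretch_image_Ioo hτ]
  refine Subset.trans (image_mono ?_) (image_closure_subset_closure_image (continuous_stretch hτc))
  rw [closure_prod_eq, closure_Ioo zero_ne_one]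
  exact prod_mono hIJ subset_rfl

/-- A continuous function that vanishes below the graph of `τ` over `J` vanishes on the boundary
as well. -/
lemma eq_zero_of_eq_zero_openRegion {K : Set (ℝ × ℝ)} {f : ℝ × ℝ → ℝ} (hf : ContinuousOn f K)
    (hτc : Continuous τ) (hτ : ∀ x, -d < τ x) (hIJ : I ⊆ closure J) (hK : openRegion d J τ ⊆ K)
    (h : ∀ z ∈ openRegion d J τ, f z = 0) {z : ℝ × ℝ} (hz : z ∈ closedRegion d I τ)
    (hzK : z ∈ K) : f z = 0 := by
  have h1 : f z ∈ closure (f '' openRegion d J τ) :=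
    ((hf z hzK).mono hK).mem_closure_image (closedRegion_subset_closure hτc hτ hIJ hz)
  have h2 : f '' openRegion d J τ ⊆ {0} := by
    rintro _ ⟨w, hw, rfl⟩; exact h w hw
  simpa using closure_mono h2 h1

lemma closedRegion_univ : closedRegion d univ τ = closedFluidDomain d τ := by
  ext z; simp [closedRegion, closedFluidDomain]

lemma openRegion_univ : openRegion d univ τ = fluidDomain d τ := by
  ext z; simp [openRegion, fluidDomain]

/-- The closed region below a differentiable graph is the image of a strip under a diffeomorphism,
so that derivatives relative to it are unique. -/
lemma uniqueDiffOn_closedFluidDomain (hτd : Differentiable ℝ τ) (hτ : ∀ x, -d < τ x) :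
    UniqueDiffOn ℝ (closedFluidDomain d τ) := by
  rw [← closedRegion_univ, ← stretch_image_Icc hτ]
  rintro _ ⟨⟨x, t⟩, hw, rfl⟩
  have hu : UniqueDiffWithinAt ℝ ((univ : Set ℝ) ×ˢ Icc (0 : ℝ) 1) (x, t) :=
    (uniqueDiffOn_univ.prod (uniqueDiffOn_Icc zero_lt_one)) _ hw
  have h1 : HasFDerivAt (fun w : ℝ × ℝ => τ w.1)
      (deriv τ x • ContinuousLinearMap.fst ℝ ℝ ℝ) (x, t) :=
    (hτd x).hasDerivAt.comp_hasFDerivAt (x, t)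
      (hasFDerivAt_fst (𝕜 := ℝ) (E := ℝ) (F := ℝ) (p := (x, t)))
  have h2 := (hasFDerivAt_fst (𝕜 := ℝ) (E := ℝ) (F := ℝ) (p := (x, t))).prodMk
    (((hasFDerivAt_snd (𝕜 := ℝ) (E := ℝ) (F := ℝ) (p := (x, t))).mul
      (h1.add_const d)).const_add (-d))
  refine HasFDerivWithinAt.uniqueDiffWithinAt (h2.hasFDerivWithinAt) hu ?_
  refine Function.Surjective.denseRange fun v => ?_
  have h0 : τ x + d ≠ 0 := by linarith [hτ x]
  refine ⟨(v.1, (v.2 - t * deriv τ x * v.1) / (τ x + d)), ?_⟩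
  ext
  · simp
  · simp
    field_simp
    ring

/-- A `2π`-periodic even function takes all its values on `[0, π]`. -/
lemma exists_mem_Icc_zero_pi {h : ℝ → ℝ} (hper : ∀ x, h (x + 2 * Real.pi) = h x)
    (heven : ∀ x, h (-x) = h x) (x : ℝ) : ∃ x' ∈ Icc 0 Real.pi, h x' = h x := by
  obtain ⟨y, hy, hxy⟩ := Function.Periodic.exists_mem_Ico hper Real.two_pi_pos x (-Real.pi)
  refine ⟨|y|, ⟨abs_nonneg _, abs_le.2 ⟨hy.1, by linarith [hy.2]⟩⟩, ?_⟩
  rcases abs_choice y with h1 | h1 <;> rw [h1]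
  · exact hxy.symm
  · rw [heven]; exact hxy.symm

/-- On the set `K`, the function `q` is `2π`-periodic and even in `x`. -/
structure SymmetricOn (K : Set (ℝ × ℝ)) (q : ℝ × ℝ → ℝ) : Prop where
  periodic : ∀ x y, (x, y) ∈ K → q (x + 2 * Real.pi, y) = q (x, y)
  even : ∀ x y, (x, y) ∈ K → q (-x, y) = q (x, y)

lemma closedFluidDomain_mono {τ' : ℝ → ℝ} (h : ∀ x, τ x ≤ τ' x) :
    closedFluidDomain d τ ⊆ closedFluidDomain d τ' :=
  fun _ hz => ⟨hz.1, hz.2.trans (h _)⟩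

/-- Below a periodic even graph, the values of a symmetric function are taken over `[0, π]`, at the
same relative height. -/
lemma SymmetricOn.exists_mem_Icc {q : ℝ × ℝ → ℝ} (hq : SymmetricOn (closedFluidDomain d τ) q)
    (hτ : ∀ x, -d < τ x) (hper : ∀ x, τ (x + 2 * Real.pi) = τ x) (heven : ∀ x, τ (-x) = τ x)
    {z : ℝ × ℝ} (hz : z ∈ closedFluidDomain d τ) :
    ∃ z' ∈ closedFluidDomain d τ, z'.1 ∈ Icc 0 Real.pi ∧ q z' = q z ∧
      (-d < z.2 → -d < z'.2) ∧ (z.2 < τ z.1 → z'.2 < τ z'.1) := by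
  have hmem : ∀ x, ∀ t ∈ Icc (0 : ℝ) 1, stretch d τ (x, t) ∈ closedFluidDomain d τ := by
    intro x t ht
    rw [← closedRegion_univ, ← stretch_image_Icc hτ]
    exact ⟨(x, t), ⟨mem_univ _, ht⟩, rfl⟩
  have hz0 := hz
  rw [← closedRegion_univ, ← stretch_image_Icc hτ] at hz
  obtain ⟨⟨x, t⟩, ⟨-, ht⟩, rfl⟩ := hz
  simp only at ht
  obtain ⟨x', hx', heq⟩ := exists_mem_Icc_zero_pi (h := fun x => q (stretch d τ (x, t)))
    (fun x => by
      have := hq.periodic x _ (hmem x t ht)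
      simp only [stretch] at this ⊢
      rwa [hper])
    (fun x => by
      have := hq.even x _ (hmem x t ht)
      simp only [stretch] at this ⊢
      rwa [heven]) x
  refine ⟨stretch d τ (x', t), hmem x' t ht, hx', heq, ?_, ?_⟩
  · intro h
    simp only [stretch] at h ⊢
    have h1 : 0 < t := by nlinarith [hτ x, ht.1]
    nlinarith [hτ x']
  · intro h
    simp only [stretch] at h ⊢
    have h1 : t < 1 := by
      by_contra hcon
      nlinarith [hτ x]
    nlinarith [hτ x']

lemma SymmetricOn.exists_isMaxOn {q : ℝ × ℝ → ℝ} (hq : SymmetricOn (closedFluidDomain d τ) q)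
    (hqc : ContinuousOn q (closedFluidDomain d τ)) (hτc : Continuous τ)
    (hτ : ∀ x, -d < τ x) (hper : ∀ x, τ (x + 2 * Real.pi) = τ x) (heven : ∀ x, τ (-x) = τ x) :
    ∃ z ∈ closedFluidDomain d τ, ∀ z' ∈ closedFluidDomain d τ, q z' ≤ q z := by
  have hsub : closedRegion d (Icc 0 Real.pi) τ ⊆ closedFluidDomain d τ := fun z hz => hz.2
  obtain ⟨z, hz, hmax⟩ := (isCompact_closedRegion hτc hτ isCompact_Icc).exists_isMaxOn
    (⟨(0, -d), ⟨⟨le_rfl, Real.pi_pos.le⟩, le_rfl, (hτ 0).le⟩⟩) (hqc.mono hsub)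
  refine ⟨z, hsub hz, fun z' hz' => ?_⟩
  obtain ⟨z'', hz'', hx, heq, -⟩ := hq.exists_mem_Icc hτ hper heven hz'
  rw [← heq]
  exact hmax ⟨hx, hz''⟩

end Region

/-! ### Regularity and symmetry of the stream function -/

lemma isOpen_fluidDomain {d : ℝ} {η : ℝ → ℝ} (hη : Continuous η) : IsOpen (fluidDomain d η) := by
  rw [← openRegion_univ]; exact isOpen_openRegion hη isOpen_univ

lemma fluidDomain_subset (d : ℝ) (η : ℝ → ℝ) : fluidDomain d η ⊆ closedFluidDomain d η :=
  fun _ hz => ⟨hz.1.le, hz.2.le⟩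

namespace IsSteadyWave

variable {d g c C p₀ : ℝ} {γ η : ℝ → ℝ} {ψ : ℝ × ℝ → ℝ}

section Basic

variable (hW : IsSteadyWave d g c C p₀ γ η ψ)
include hW

lemma continuous_surface : Continuous η := hW.surface_smooth.continuous

lemma differentiable_surface : Differentiable ℝ η := hW.surface_smooth.differentiable (by norm_num)

lemma isOpen_domain : IsOpen (fluidDomain d η) := isOpen_fluidDomain hW.continuous_surface

lemma uniqueDiffOn : UniqueDiffOn ℝ (closedFluidDomain d η) :=
  uniqueDiffOn_closedFluidDomain hW.differentiable_surface hW.surface_above_bed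

lemma closed_mem_nhds {z : ℝ × ℝ} (hz : z ∈ fluidDomain d η) : closedFluidDomain d η ∈ 𝓝 z :=
  mem_of_superset (hW.isOpen_domain.mem_nhds hz) (fluidDomain_subset d η)

lemma hasFDerivWithinAt {z : ℝ × ℝ} (hz : z ∈ closedFluidDomain d η) :
    HasFDerivWithinAt ψ (fderivWithin ℝ ψ (closedFluidDomain d η) z) (closedFluidDomain d η) z :=
  (hW.stream_smooth.differentiableOn two_ne_zero z hz).hasFDerivWithinAt

lemma contDiffOn_partialX :
    ContDiffOn ℝ 1 (partialX (closedFluidDomain d η) ψ) (closedFluidDomain d η) :=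
  (hW.stream_smooth.fderivWithin hW.uniqueDiffOn (by norm_num)).clm_apply contDiffOn_const

lemma contDiffOn_partialY :
    ContDiffOn ℝ 1 (partialY (closedFluidDomain d η) ψ) (closedFluidDomain d η) :=
  (hW.stream_smooth.fderivWithin hW.uniqueDiffOn (by norm_num)).clm_apply contDiffOn_const

lemma fderiv_partialX_add_fderiv_partialY {z : ℝ × ℝ} (hz : z ∈ fluidDomain d η) :
    fderiv ℝ (partialX (closedFluidDomain d η) ψ) z (1, 0)
      + fderiv ℝ (partialY (closedFluidDomain d η) ψ) z (0, 1) = -γ (ψ z) := by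
  rw [← hW.stream_eq z hz]
  simp only [partialX, partialY]
  rw [fderivWithin_of_mem_nhds (hW.closed_mem_nhds hz),
    fderivWithin_of_mem_nhds (hW.closed_mem_nhds hz)]

/-- Symmetry of the second derivatives. -/
lemma fderiv_partialX_eq_fderiv_partialY {z : ℝ × ℝ} (hz : z ∈ fluidDomain d η) :
    fderiv ℝ (partialX (closedFluidDomain d η) ψ) z (0, 1)
      = fderiv ℝ (partialY (closedFluidDomain d η) ψ) z (1, 0) := by
  have hψ : ContDiffAt ℝ 2 ψ z := hW.stream_smooth.contDiffAt (hW.closed_mem_nhds hz)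
  have hd : DifferentiableAt ℝ (fderiv ℝ ψ) z :=
    (hψ.fderiv_right (m := 1) (by norm_num)).differentiableAt one_ne_zero
  have hev : ∀ v : ℝ × ℝ, (fun w => fderivWithin ℝ ψ (closedFluidDomain d η) w v)
      =ᶠ[𝓝 z] fun w => fderiv ℝ ψ w v := fun v => by
    filter_upwards [hW.isOpen_domain.mem_nhds hz] with w hw
    rw [fderivWithin_of_mem_nhds (hW.closed_mem_nhds hw)]
  have hval : ∀ u v : ℝ × ℝ,
      fderiv ℝ (fun w => fderivWithin ℝ ψ (closedFluidDomain d η) w v) z u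
        = fderiv ℝ (fderiv ℝ ψ) z u v := fun u v => by
    rw [(hev v).fderiv_eq, fderiv_clm_apply hd (differentiableAt_const v)]
    simp
  have hsymm := hψ.isSymmSndFDerivAt (by simp)
  exact (hval _ _).trans ((hsymm _ _).trans (hval _ _).symm)

/-- Chain rule along a curve in the closed fluid domain. -/
lemma hasDerivWithinAt_comp {s : Set ℝ} {u v : ℝ → ℝ} {u' v' t : ℝ}
    (hu : HasDerivWithinAt u u' s t) (hv : HasDerivWithinAt v v' s t)
    (hmaps : ∀ t ∈ s, (u t, v t) ∈ closedFluidDomain d η) (ht : t ∈ s) :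
    HasDerivWithinAt (fun t => ψ (u t, v t))
      (u' * partialX (closedFluidDomain d η) ψ (u t, v t)
        + v' * partialY (closedFluidDomain d η) ψ (u t, v t)) s t := by
  have := (hW.hasFDerivWithinAt (hmaps t ht)).comp_hasDerivWithinAt t (hu.prodMk hv) hmaps
  rwa [clm_prod_apply] at this

lemma hasDerivWithinAt_vertical {x y : ℝ} (hy : y ∈ Icc (-d) (η x)) :
    HasDerivWithinAt (fun y => ψ (x, y)) (partialY (closedFluidDomain d η) ψ (x, y))
      (Icc (-d) (η x)) y := by
  simpa using hW.hasDerivWithinAt_comp (hasDerivWithinAt_const y _ x) (hasDerivWithinAt_id y _)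
    (s := Icc (-d) (η x)) (fun t ht => ht) hy

/-- Without stagnation the stream function strictly decreases from the bed to the surface. -/
lemma strictAntiOn_vertical (x : ℝ) : StrictAntiOn (fun y => ψ (x, y)) (Icc (-d) (η x)) := by
  refine strictAntiOn_of_hasDerivWithinAt_neg (f' := fun y =>
    partialY (closedFluidDomain d η) ψ (x, y)) (convex_Icc _ _)
    (fun y hy => (hW.hasDerivWithinAt_vertical hy).continuousWithinAt) ?_ ?_
  · exact fun y hy => (hW.hasDerivWithinAt_vertical (interior_subset hy)).mono interior_subset
  · exact fun y hy => hW.no_stagnation (x, y) (interior_subset (s := Icc (-d) (η x)) hy)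

lemma flux_neg : p₀ < 0 := by
  have h := hW.surface_above_bed 0
  have := hW.strictAntiOn_vertical 0 (left_mem_Icc.2 h.le) (right_mem_Icc.2 h.le) h
  simp only [hW.stream_surface, hW.stream_bed] at this
  linarith

lemma stream_mem_Icc {z : ℝ × ℝ} (hz : z ∈ closedFluidDomain d η) : ψ z ∈ Icc 0 (-p₀) := by
  have h := hW.surface_above_bed z.1
  have hanti := (hW.strictAntiOn_vertical z.1).antitoneOn
  constructor
  · rw [← hW.stream_surface z.1]; exact hanti hz (right_mem_Icc.2 h.le) hz.2
  · rw [← hW.stream_bed z.1]; exact hanti (left_mem_Icc.2 h.le) hz hz.1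

lemma stream_mem_Ioo {z : ℝ × ℝ} (hz : z ∈ fluidDomain d η) : ψ z ∈ Ioo 0 (-p₀) := by
  have h := hW.surface_above_bed z.1
  have hanti := hW.strictAntiOn_vertical z.1
  have hz' : z.2 ∈ Icc (-d) (η z.1) := ⟨hz.1.le, hz.2.le⟩
  constructor
  · rw [← hW.stream_surface z.1]; exact hanti hz' (right_mem_Icc.2 h.le) hz.2
  · rw [← hW.stream_bed z.1]; exact hanti (left_mem_Icc.2 h.le) hz' hz.1

lemma contDiffOn_vorticity : ContDiffOn ℝ 1 (fun z => -γ (ψ z)) (fluidDomain d η) :=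
  (hW.vorticity_smooth.comp ((hW.stream_smooth.mono (fluidDomain_subset d η)).of_le
    (by norm_num)) fun _ hz => Ioo_subset_Icc_self (hW.stream_mem_Ioo hz)).neg

lemma fderiv_vorticity {z : ℝ × ℝ} (hz : z ∈ fluidDomain d η) (v : ℝ × ℝ) :
    fderiv ℝ (fun z => -γ (ψ z)) z v = -(derivWithin γ (Icc 0 (-p₀)) (ψ z)
      * fderivWithin ℝ ψ (closedFluidDomain d η) z v) := by
  have hmem := hW.stream_mem_Ioo hz
  have hnhds : Icc 0 (-p₀) ∈ 𝓝 (ψ z) := Icc_mem_nhds hmem.1 hmem.2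
  have hγ : HasDerivAt γ (derivWithin γ (Icc 0 (-p₀)) (ψ z)) (ψ z) :=
    (hW.vorticity_smooth.differentiableOn one_ne_zero _
      (Ioo_subset_Icc_self hmem)).hasDerivWithinAt.hasDerivAt hnhds
  have hψ := (hW.hasFDerivWithinAt (fluidDomain_subset d η hz)).hasFDerivAt (hW.closed_mem_nhds hz)
  have h := (hγ.comp_hasFDerivAt z hψ).neg
  rw [show (fun z => -γ (ψ z)) = -(γ ∘ ψ) from rfl, h.fderiv]
  simp

/-- A symmetry of the closed fluid domain that preserves `ψ` transforms its derivative
accordingly. -/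
lemma fderivWithin_comp_symmetry {T : ℝ × ℝ → ℝ × ℝ} {L : ℝ × ℝ →L[ℝ] ℝ × ℝ} {z : ℝ × ℝ}
    (hT : HasFDerivAt T L z) (hmaps : MapsTo T (closedFluidDomain d η) (closedFluidDomain d η))
    (hψ : ∀ z ∈ closedFluidDomain d η, ψ (T z) = ψ z) (hz : z ∈ closedFluidDomain d η)
    (v : ℝ × ℝ) : fderivWithin ℝ ψ (closedFluidDomain d η) (T z) (L v)
      = fderivWithin ℝ ψ (closedFluidDomain d η) z v := by
  have h1 := (hW.hasFDerivWithinAt (hmaps hz)).comp z hT.hasFDerivWithinAt hmaps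
  have h2 := h1.congr (f₁ := ψ) (fun w hw => (hψ w hw).symm) (hψ z hz).symm
  rw [h2.fderivWithin (hW.uniqueDiffOn z hz)]
  rfl

lemma fderivWithin_translate {z : ℝ × ℝ} (hz : z ∈ closedFluidDomain d η) (v : ℝ × ℝ) :
    fderivWithin ℝ ψ (closedFluidDomain d η) (z.1 + 2 * Real.pi, z.2) v
      = fderivWithin ℝ ψ (closedFluidDomain d η) z v := by
  have hT : HasFDerivAt (fun w : ℝ × ℝ => (w.1 + 2 * Real.pi, w.2))
      ((ContinuousLinearMap.fst ℝ ℝ ℝ).prod (ContinuousLinearMap.snd ℝ ℝ ℝ)) z :=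
    (hasFDerivAt_fst.add_const _).prodMk hasFDerivAt_snd
  have := hW.fderivWithin_comp_symmetry hT
    (fun w hw => ⟨hw.1, by simpa only [hW.surface_periodic] using hw.2⟩) hW.stream_periodic hz v
  simpa using this

lemma fderivWithin_reflect {z : ℝ × ℝ} (hz : z ∈ closedFluidDomain d η) (v : ℝ × ℝ) :
    fderivWithin ℝ ψ (closedFluidDomain d η) (-z.1, z.2) (-v.1, v.2)
      = fderivWithin ℝ ψ (closedFluidDomain d η) z v := by
  have hT : HasFDerivAt (fun w : ℝ × ℝ => (-w.1, w.2))
      ((-ContinuousLinearMap.fst ℝ ℝ ℝ).prod (ContinuousLinearMap.snd ℝ ℝ ℝ)) z :=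
    hasFDerivAt_fst.neg.prodMk hasFDerivAt_snd
  have := hW.fderivWithin_comp_symmetry hT
    (fun w hw => ⟨hw.1, by simpa only [hW.surface_even] using hw.2⟩) hW.stream_even hz v
  simpa using this

lemma partialX_translate {x y : ℝ} (hz : (x, y) ∈ closedFluidDomain d η) :
    partialX (closedFluidDomain d η) ψ (x + 2 * Real.pi, y)
      = partialX (closedFluidDomain d η) ψ (x, y) :=
  hW.fderivWithin_translate hz _

lemma partialY_translate {x y : ℝ} (hz : (x, y) ∈ closedFluidDomain d η) :
    partialY (closedFluidDomain d η) ψ (x + 2 * Real.pi, y)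
      = partialY (closedFluidDomain d η) ψ (x, y) :=
  hW.fderivWithin_translate hz _

lemma partialX_reflect {x y : ℝ} (hz : (x, y) ∈ closedFluidDomain d η) :
    partialX (closedFluidDomain d η) ψ (-x, y) = -partialX (closedFluidDomain d η) ψ (x, y) := by
  have := hW.fderivWithin_reflect hz (1, 0)
  simp only [partialX]
  rw [← this, ← map_neg]
  simp

lemma partialY_reflect {x y : ℝ} (hz : (x, y) ∈ closedFluidDomain d η) :
    partialY (closedFluidDomain d η) ψ (-x, y) = partialY (closedFluidDomain d η) ψ (x, y) := by
  have := hW.fderivWithin_reflect hz (0, 1)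
  simpa [partialY] using this

lemma partialX_crest {y : ℝ} (hz : (0, y) ∈ closedFluidDomain d η) :
    partialX (closedFluidDomain d η) ψ (0, y) = 0 := by
  have := hW.partialX_reflect hz
  rw [neg_zero] at this
  linarith

lemma partialX_trough {y : ℝ} (hz : (Real.pi, y) ∈ closedFluidDomain d η) :
    partialX (closedFluidDomain d η) ψ (Real.pi, y) = 0 := by
  have hη : η (-Real.pi) = η Real.pi := hW.surface_even _
  have h1 := hW.partialX_reflect hz
  have h2 := hW.partialX_translate (x := -Real.pi) (y := y) ⟨hz.1, by simpa only [hη] using hz.2⟩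
  rw [show -Real.pi + 2 * Real.pi = Real.pi by ring] at h2
  linarith

lemma mem_bed (x : ℝ) : (x, -d) ∈ closedFluidDomain d η := ⟨le_rfl, (hW.surface_above_bed x).le⟩

lemma mem_surface (x : ℝ) : (x, η x) ∈ closedFluidDomain d η :=
  ⟨(hW.surface_above_bed x).le, le_rfl⟩

/-- Along a differentiable curve `y = σ x` on which `ψ` is constant, `ψ_x + σ' ψ_y = 0`. -/
lemma partialX_add_deriv_mul_partialY {σ : ℝ → ℝ} {x k : ℝ} (hσ : DifferentiableAt ℝ σ x)
    (hmem : ∀ x, (x, σ x) ∈ closedFluidDomain d η) (hk : ∀ x, ψ (x, σ x) = k) :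
    partialX (closedFluidDomain d η) ψ (x, σ x)
      + deriv σ x * partialY (closedFluidDomain d η) ψ (x, σ x) = 0 := by
  have h := hW.hasDerivWithinAt_comp (s := univ) (t := x) (hasDerivWithinAt_id x _)
    hσ.hasDerivAt.hasDerivWithinAt (fun t _ => hmem t) (mem_univ x)
  rw [hasDerivWithinAt_univ] at h
  simp only [id, hk, one_mul] at h
  exact h.unique (hasDerivAt_const x k)

lemma partialX_bed (x : ℝ) : partialX (closedFluidDomain d η) ψ (x, -d) = 0 := by
  simpa using hW.partialX_add_deriv_mul_partialY (σ := fun _ => -d) (x := x)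
    (differentiableAt_const _) hW.mem_bed hW.stream_bed

lemma partialX_surface (x : ℝ) : partialX (closedFluidDomain d η) ψ (x, η x)
    + deriv η x * partialY (closedFluidDomain d η) ψ (x, η x) = 0 :=
  hW.partialX_add_deriv_mul_partialY (hW.differentiable_surface x) hW.mem_surface
    hW.stream_surface

lemma exists_deriv_vorticity_le :
    ∃ K, ∀ z ∈ closedFluidDomain d η, |derivWithin γ (Icc 0 (-p₀)) (ψ z)| ≤ K := by
  have hu : UniqueDiffOn ℝ (Icc 0 (-p₀)) := uniqueDiffOn_Icc (by linarith [hW.flux_neg])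
  obtain ⟨K, hK⟩ := isCompact_Icc.exists_bound_of_continuousOn
    (hW.vorticity_smooth.continuousOn_derivWithin hu le_rfl)
  exact ⟨K, fun z hz => hK _ (hW.stream_mem_Icc hz)⟩

end Basic

/-- The strong maximum principle for `m + s y + a ψ_x + b ψ_y`: the derivatives of the stream
function solve `Δ(aψ_x + bψ_y) = -γ'(ψ) (aψ_x + bψ_y)` weakly, and `C²` regularity of `ψ` is
enough. -/
lemma eq_zero_of_nonneg (hW : IsSteadyWave d g c C p₀ γ η ψ) {U : Set (ℝ × ℝ)} (hU : IsOpen U)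
    (hUc : IsPreconnected U) (hUΩ : U ⊆ fluidDomain d η) {f : ℝ × ℝ → ℝ} (m s a b K : ℝ)
    (hf : ∀ z, f z = m + s * z.2 + a * partialX (closedFluidDomain d η) ψ z
      + b * partialY (closedFluidDomain d η) ψ z)
    (hpos : ∀ z ∈ U, 0 ≤ f z)
    (hK : ∀ z ∈ U, -(derivWithin γ (Icc 0 (-p₀)) (ψ z)
      * (a * partialX (closedFluidDomain d η) ψ z + b * partialY (closedFluidDomain d η) ψ z))
        ≤ K * f z)
    {z : ℝ × ℝ} (hz : z ∈ U) (hfz : f z = 0) : ∀ w ∈ U, f w = 0 := by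
  set P := partialX (closedFluidDomain d η) ψ with hP
  set Q := partialY (closedFluidDomain d η) ψ with hQ
  have hPU : ContDiffOn ℝ 1 P U :=
    hW.contDiffOn_partialX.mono (hUΩ.trans (fluidDomain_subset d η))
  have hQU : ContDiffOn ℝ 1 Q U :=
    hW.contDiffOn_partialY.mono (hUΩ.trans (fluidDomain_subset d η))
  have hPd : ∀ w ∈ U, HasFDerivAt P (fderiv ℝ P w) w := fun w hw =>
    ((hPU.contDiffAt (hU.mem_nhds hw)).differentiableAt one_ne_zero).hasFDerivAt
  have hQd : ∀ w ∈ U, HasFDerivAt Q (fderiv ℝ Q w) w := fun w hw =>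
    ((hQU.contDiffAt (hU.mem_nhds hw)).differentiableAt one_ne_zero).hasFDerivAt
  have hf' : f = fun z => m + s * z.2 + a * P z + b * Q z := funext hf
  have hdf : ∀ w ∈ U, ∀ v, fderiv ℝ f w v
      = s * v.2 + a * fderiv ℝ P w v + b * fderiv ℝ Q w v := fun w hw v => by
    have h := ((((hasFDerivAt_snd (𝕜 := ℝ) (E := ℝ) (F := ℝ) (p := w)).const_mul s).const_add
      m).add ((hPd w hw).const_mul a)).add ((hQd w hw).const_mul b)
    rw [hf']
    refine (DFunLike.congr_fun h.fderiv v).trans ?_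
    simp
  have hdg : ∀ w ∈ U, ∀ v, fderiv ℝ (fun z : ℝ × ℝ => -s * z.1 + b * P z + (-a) * Q z) w v
      = -s * v.1 + b * fderiv ℝ P w v - a * fderiv ℝ Q w v := fun w hw v => by
    have h := (((hasFDerivAt_fst (𝕜 := ℝ) (E := ℝ) (F := ℝ) (p := w)).const_mul (-s)).add
      ((hPd w hw).const_mul b)).add ((hQd w hw).const_mul (-a))
    refine (DFunLike.congr_fun h.fderiv v).trans ?_
    simp
    ring
  refine eq_zero_of_cauchyRiemann (a := a) (b := b) (K := K)
    (g := fun z => -s * z.1 + b * P z + (-a) * Q z)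
    (G := fun z => -γ (ψ z)) hU hUc ?_ ?_ (hW.contDiffOn_vorticity.mono hUΩ) ?_ ?_ hpos ?_ hz hfz
  · rw [hf']; fun_prop
  · fun_prop
  · intro w hw
    have h1 := hW.fderiv_partialX_add_fderiv_partialY (hUΩ hw)
    have h2 := hW.fderiv_partialX_eq_fderiv_partialY (hUΩ hw)
    rw [hdf w hw, hdg w hw, ← h1, h2]
    simp only
    ring
  · intro w hw
    have h1 := hW.fderiv_partialX_add_fderiv_partialY (hUΩ hw)
    have h2 := hW.fderiv_partialX_eq_fderiv_partialY (hUΩ hw)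
    rw [hdf w hw, hdg w hw, ← h1, h2]
    simp only
    ring
  · intro w hw
    have h := hK w hw
    rw [hW.fderiv_vorticity (hUΩ hw), hW.fderiv_vorticity (hUΩ hw)]
    refine le_trans (le_of_eq ?_) h
    simp only [hP, hQ, partialX, partialY]
    ring

end IsSteadyWave

/-! ### Streamlines -/

section Streamline

variable {d g c C p₀ p p₁ p₂ : ℝ} {γ η σ σ₁ σ₂ : ℝ → ℝ} {ψ : ℝ × ℝ → ℝ}

namespace IsStreamline

lemma mem (hσ : IsStreamline d η ψ p σ) (x : ℝ) : (x, σ x) ∈ closedFluidDomain d η :=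
  ((hσ (x, σ x)).2 rfl).1

lemma stream_eq (hσ : IsStreamline d η ψ p σ) (x : ℝ) : ψ (x, σ x) = -p :=
  ((hσ (x, σ x)).2 rfl).2

lemma unique (h₁ : IsStreamline d η ψ p σ₁) (h₂ : IsStreamline d η ψ p σ₂) : σ₁ = σ₂ :=
  funext fun x => (h₂ (x, σ₁ x)).1 ⟨h₁.mem x, h₁.stream_eq x⟩

section

variable (hW : IsSteadyWave d g c C p₀ γ η ψ)
include hW

lemma mem_Icc (hσ : IsStreamline d η ψ p σ) : p ∈ Icc p₀ 0 := by
  have h := hW.stream_mem_Icc (hσ.mem 0)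
  rw [hσ.stream_eq] at h
  exact ⟨by linarith [h.2], by linarith [h.1]⟩

lemma of_stream_eq (hmem : ∀ x, (x, σ x) ∈ closedFluidDomain d η)
    (heq : ∀ x, ψ (x, σ x) = -p) : IsStreamline d η ψ p σ := by
  rintro ⟨x, y⟩
  constructor
  · rintro ⟨hz, hp⟩
    exact (hW.strictAntiOn_vertical x).injOn hz (hmem x) (hp.trans (heq x).symm)
  · rintro h
    simp only at h
    subst h
    exact ⟨hmem x, heq x⟩

lemma bed : IsStreamline d η ψ p₀ (fun _ => -d) :=
  of_stream_eq hW hW.mem_bed hW.stream_bed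

lemma surface : IsStreamline d η ψ 0 η :=
  of_stream_eq hW hW.mem_surface fun x => by rw [hW.stream_surface, neg_zero]

lemma exists_of_mem_Icc (hp : p ∈ Icc p₀ 0) : ∃ σ, IsStreamline d η ψ p σ := by
  have h : ∀ x, ∃ y ∈ Icc (-d) (η x), ψ (x, y) = -p := fun x => by
    have := intermediate_value_Icc' (hW.surface_above_bed x).le
      (fun y hy => (hW.hasDerivWithinAt_vertical (x := x) hy).continuousWithinAt)
    refine this ⟨?_, ?_⟩
    · rw [hW.stream_surface]; linarith [hp.2]
    · rw [hW.stream_bed]; linarith [hp.1]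
  choose σ hσ heq using h
  exact ⟨σ, of_stream_eq hW hσ heq⟩

lemma lt_of_lt (h₁ : IsStreamline d η ψ p₁ σ₁) (h₂ : IsStreamline d η ψ p₂ σ₂) (hp : p₁ < p₂)
    (x : ℝ) : σ₁ x < σ₂ x := by
  by_contra hcon
  push Not at hcon
  have := (hW.strictAntiOn_vertical x).antitoneOn (h₂.mem x) (h₁.mem x) hcon
  simp only [h₁.stream_eq, h₂.stream_eq] at this
  linarith

lemma bed_lt (hσ : IsStreamline d η ψ p σ) (hp : p₀ < p) (x : ℝ) : -d < σ x :=
  (bed hW).lt_of_lt hW hσ hp x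

lemma differentiable (hσ : IsStreamline d η ψ p σ) : Differentiable ℝ σ := by
  rcases (hσ.mem_Icc hW).1.eq_or_lt with rfl | hp
  · rw [hσ.unique (bed hW)]; exact differentiable_const _
  rcases (hσ.mem_Icc hW).2.eq_or_lt with rfl | hp'
  · rw [hσ.unique (surface hW)]; exact hW.differentiable_surface
  -- an interior streamline is locally given by the implicit function theorem
  intro x
  have hz : (x, σ x) ∈ fluidDomain d η :=
    ⟨hσ.bed_lt hW hp x, hσ.lt_of_lt hW (surface hW) hp' x⟩
  have hψ : ContDiffAt ℝ 2 ψ (x, σ x) := hW.stream_smooth.contDiffAt (hW.closed_mem_nhds hz)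
  have hstrict := hψ.hasStrictFDerivAt two_ne_zero
  have hy : fderiv ℝ ψ (x, σ x) (0, 1) ≠ 0 := by
    have := hW.no_stagnation _ (hσ.mem x)
    rw [partialY, fderivWithin_of_mem_nhds (hW.closed_mem_nhds hz)] at this
    exact this.ne
  have hinv : (fderiv ℝ ψ (x, σ x) ∘L .inr ℝ ℝ ℝ).IsInvertible := by
    refine ⟨ContinuousLinearEquiv.unitsEquivAut ℝ (Units.mk0 _ hy), ?_⟩
    ext
    simp
  have htend := hstrict.tendsto_implicitFunctionOfProdDomain hinv
  have hval := hstrict.eventually_apply_implicitFunctionOfProdDomain hinv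
  have hd := (hstrict.hasStrictFDerivAt_implicitFunctionOfProdDomain hinv).differentiableAt
  refine hd.congr_of_eventuallyEq ?_
  have hmem : ∀ᶠ x' in 𝓝 x,
      (x', hstrict.implicitFunctionOfProdDomain hinv x') ∈ fluidDomain d η :=
    (tendsto_id.prodMk_nhds htend).eventually (hW.isOpen_domain.mem_nhds hz)
  filter_upwards [hval, hmem] with x' h1 h2
  rw [hσ.stream_eq] at h1
  exact ((hσ _).1 ⟨fluidDomain_subset d η h2, h1⟩).symm

lemma deriv_eq (hσ : IsStreamline d η ψ p σ) (x : ℝ) :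
    deriv σ x = -(partialX (closedFluidDomain d η) ψ (x, σ x)
      / partialY (closedFluidDomain d η) ψ (x, σ x)) := by
  have h := hW.partialX_add_deriv_mul_partialY (hσ.differentiable hW x) hσ.mem hσ.stream_eq
  have hy := (hW.no_stagnation _ (hσ.mem x)).ne
  field_simp
  linarith

lemma periodic (hσ : IsStreamline d η ψ p σ) (x : ℝ) : σ (x + 2 * Real.pi) = σ x := by
  refine ((hσ (x + 2 * Real.pi, σ x)).1 ⟨?_, ?_⟩).symm
  · have := hσ.mem x
    exact ⟨this.1, by simpa only [hW.surface_periodic] using this.2⟩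
  · exact (hW.stream_periodic _ (hσ.mem x)).trans (hσ.stream_eq x)

lemma even (hσ : IsStreamline d η ψ p σ) (x : ℝ) : σ (-x) = σ x := by
  refine ((hσ (-x, σ x)).1 ⟨?_, ?_⟩).symm
  · have := hσ.mem x
    exact ⟨this.1, by simpa only [hW.surface_even] using this.2⟩
  · exact (hW.stream_even _ (hσ.mem x)).trans (hσ.stream_eq x)

end

end IsStreamline

lemma SymmetricOn.mono {K K' : Set (ℝ × ℝ)} {q : ℝ × ℝ → ℝ} (hq : SymmetricOn K q) (h : K' ⊆ K) :
    SymmetricOn K' q :=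
  ⟨fun x y hz => hq.periodic x y (h hz), fun x y hz => hq.even x y (h hz)⟩

/-- Reduction of the monotonicity of maxima along streamlines to a maximum principle: it is enough
that a maximum over the region below a streamline is never attained strictly below that
streamline. -/
lemma maxStrictlyIncreasesUpwards_of_maximum_principle (hW : IsSteadyWave d g c C p₀ γ η ψ)
    {F : (ℝ → ℝ) → ℝ → ℝ} {q : ℝ × ℝ → ℝ}
    (hF : ∀ p σ, IsStreamline d η ψ p σ → ∀ x, F σ x = q (x, σ x))
    (hqc : ContinuousOn q (closedFluidDomain d η)) (hq : SymmetricOn (closedFluidDomain d η) q)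
    (hmax : ∀ p σ, IsStreamline d η ψ p σ → p₀ < p → ∀ z ∈ closedFluidDomain d σ,
      z.2 < σ z.1 → (∀ z' ∈ closedFluidDomain d σ, q z' ≤ q z) → False) :
    MaxStrictlyIncreasesUpwards d p₀ η ψ F := by
  have hgreatest : ∀ p σ, IsStreamline d η ψ p σ → ∃ m, IsGreatest (range (F σ)) m := by
    intro p σ hσ
    have hcont : Continuous fun x => q (x, σ x) :=
      hqc.comp_continuous (continuous_id.prodMk (hσ.differentiable hW).continuous) hσ.mem
    obtain ⟨x₀, -, hx₀⟩ := isCompact_Icc.exists_isMaxOn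
      (nonempty_Icc.2 Real.pi_pos.le) hcont.continuousOn
    refine ⟨q (x₀, σ x₀), ⟨x₀, hF p σ hσ x₀⟩, ?_⟩
    rintro _ ⟨x, rfl⟩
    obtain ⟨x', hx', heq⟩ := exists_mem_Icc_zero_pi (h := fun x => q (x, σ x))
      (fun x => by rw [hσ.periodic hW]; exact hq.periodic _ _ (hσ.mem x))
      (fun x => by rw [hσ.even hW]; exact hq.even _ _ (hσ.mem x)) x
    rw [hF p σ hσ, ← heq]
    exact hx₀ hx'
  have hset : ∀ {p σ}, IsStreamline d η ψ p σ →
      {t | ∃ σ, IsStreamline d η ψ p σ ∧ t ∈ range (F σ)} = range (F σ) := by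
    intro p σ hσ
    ext t
    constructor
    · rintro ⟨σ', hσ', ht⟩
      rwa [hσ.unique hσ']
    · exact fun ht => ⟨σ, hσ, ht⟩
  refine ⟨fun p => sSup {t | ∃ σ, IsStreamline d η ψ p σ ∧ t ∈ range (F σ)}, ?_, ?_⟩
  · intro p _ σ hσ
    obtain ⟨m, hm⟩ := hgreatest p σ hσ
    simp only [hset hσ]
    rwa [hm.csSup_eq]
  · intro p₁ hp₁ p₂ hp₂ hlt
    obtain ⟨σ₁, h₁⟩ := IsStreamline.exists_of_mem_Icc hW hp₁
    obtain ⟨σ₂, h₂⟩ := IsStreamline.exists_of_mem_Icc hW hp₂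
    simp only [hset h₁, hset h₂]
    obtain ⟨m₁, hm₁⟩ := hgreatest p₁ σ₁ h₁
    obtain ⟨m₂, hm₂⟩ := hgreatest p₂ σ₂ h₂
    rw [hm₁.csSup_eq, hm₂.csSup_eq]
    have hp : p₀ < p₂ := hp₁.1.trans_lt hlt
    have hsub : closedFluidDomain d σ₂ ⊆ closedFluidDomain d η :=
      closedFluidDomain_mono fun x => (h₂.mem x).2
    obtain ⟨z, hz, hzmax⟩ := (hq.mono hsub).exists_isMaxOn (hqc.mono hsub)
      (h₂.differentiable hW).continuous (h₂.bed_lt hW hp) (h₂.periodic hW) (h₂.even hW)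
    -- the maximum over the region below the upper streamline lies on that streamline
    have hz2 : z.2 = σ₂ z.1 := by
      by_contra hne
      exact hmax p₂ σ₂ h₂ hp z hz (lt_of_le_of_ne hz.2 hne) hzmax
    have hzm : q z ≤ m₂ := by
      have := hm₂.2 ⟨z.1, rfl⟩
      rwa [hF p₂ σ₂ h₂, ← hz2] at this
    obtain ⟨x₁, hx₁⟩ := hm₁.1
    rw [hF p₁ σ₁ h₁] at hx₁
    have hlt' := h₁.lt_of_lt hW h₂ hlt x₁
    have hmem : (x₁, σ₁ x₁) ∈ closedFluidDomain d σ₂ := ⟨(h₁.mem x₁).1, hlt'.le⟩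
    rw [← hx₁]
    refine lt_of_lt_of_le (lt_of_not_ge fun hge => ?_) hzm
    exact hmax p₂ σ₂ h₂ hp _ hmem hlt' fun z' hz' => (hzmax z' hz').trans hge

end Streamline

/-! ### Maximum principles below a streamline -/

namespace IsSteadyWave

variable {d g c C p₀ p : ℝ} {γ η σ : ℝ → ℝ} {ψ : ℝ × ℝ → ℝ}

lemma symmetricOn_partialY (hW : IsSteadyWave d g c C p₀ γ η ψ) :
    SymmetricOn (closedFluidDomain d η) (partialY (closedFluidDomain d η) ψ) :=
  ⟨fun _ _ hz => hW.partialY_translate hz, fun _ _ hz => hW.partialY_reflect hz⟩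

lemma symmetricOn_abs_partialX (hW : IsSteadyWave d g c C p₀ γ η ψ) :
    SymmetricOn (closedFluidDomain d η) fun z => |partialX (closedFluidDomain d η) ψ z| :=
  ⟨fun _ _ hz => by rw [hW.partialX_translate hz],
    fun _ _ hz => by rw [hW.partialX_reflect hz, abs_neg]⟩

lemma symmetricOn_abs_slope (hW : IsSteadyWave d g c C p₀ γ η ψ) :
    SymmetricOn (closedFluidDomain d η) fun z => |partialX (closedFluidDomain d η) ψ z
      / partialY (closedFluidDomain d η) ψ z| :=
  ⟨fun _ _ hz => by rw [hW.partialX_translate hz, hW.partialY_translate hz],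
    fun _ _ hz => by rw [hW.partialX_reflect hz, hW.partialY_reflect hz, neg_div, abs_neg]⟩

lemma continuousOn_slope (hW : IsSteadyWave d g c C p₀ γ η ψ) :
    ContinuousOn (fun z => partialX (closedFluidDomain d η) ψ z
      / partialY (closedFluidDomain d η) ψ z) (closedFluidDomain d η) :=
  hW.contDiffOn_partialX.continuousOn.div hW.contDiffOn_partialY.continuousOn
    fun z hz => (hW.no_stagnation z hz).ne

lemma pi_div_two_mem : Real.pi / 2 ∈ Ioo 0 Real.pi :=
  ⟨by linarith [Real.pi_pos], by linarith [Real.pi_pos]⟩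

lemma partialX_surface_neg (hW : IsSteadyWave d g c C p₀ γ η ψ) {x : ℝ}
    (hx : x ∈ Ioo 0 Real.pi) : partialX (closedFluidDomain d η) ψ (x, η x) < 0 := by
  have h1 := hW.partialX_surface x
  have h2 := mul_pos_of_neg_of_neg (hW.surface_decreasing x hx)
    (hW.no_stagnation _ (hW.mem_surface x))
  linarith

/-- `ψ_x < 0` between crest and trough above the bed: the slope `ψ_x / ψ_y` vanishes on the crest
and trough lines and on the bed and is positive on the surface, so that it cannot attain a
nonpositive minimum in the interior. -/
lemma partialX_neg (hW : IsSteadyWave d g c C p₀ γ η ψ) {z : ℝ × ℝ}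
    (hz : z ∈ closedFluidDomain d η) (hx : z.1 ∈ Ioo 0 Real.pi) (hy : z.2 ≠ -d) :
    partialX (closedFluidDomain d η) ψ z < 0 := by
  by_contra hcon
  push Not at hcon
  set P := partialX (closedFluidDomain d η) ψ with hP
  set Q := partialY (closedFluidDomain d η) ψ with hQ
  have hηc := hW.continuous_surface
  have hsub : closedRegion d (Icc 0 Real.pi) η ⊆ closedFluidDomain d η := fun z hz => hz.2
  have hzD : z ∈ closedRegion d (Icc 0 Real.pi) η := ⟨Ioo_subset_Icc_self hx, hz⟩
  obtain ⟨z₀, hz₀, hmin⟩ := (isCompact_closedRegion hηc hW.surface_above_bed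
    isCompact_Icc).exists_isMinOn ⟨z, hzD⟩ (hW.continuousOn_slope.mono hsub)
  set m := P z₀ / Q z₀ with hm
  have hle : ∀ z' ∈ closedRegion d (Icc 0 Real.pi) η, m ≤ P z' / Q z' := fun z' hz' => hmin hz'
  have hwz : P z / Q z ≤ 0 := div_nonpos_of_nonneg_of_nonpos hcon (hW.no_stagnation z hz).le
  have hm0 : m ≤ 0 := (hle z hzD).trans hwz
  have hint : ∀ z' ∈ closedRegion d (Icc 0 Real.pi) η, z'.1 ∈ Ioo 0 Real.pi → z'.2 ≠ -d →
      P z' / Q z' ≤ 0 → z' ∈ openRegion d (Ioo 0 Real.pi) η := by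
    rintro ⟨x', y'⟩ hz' hx' hy' hw
    refine ⟨hx', lt_of_le_of_ne hz'.2.1 (Ne.symm hy'), lt_of_le_of_ne hz'.2.2 ?_⟩
    intro h
    simp only at h
    subst h
    exact absurd hw (not_le.2 (div_pos_of_neg_of_neg (hW.partialX_surface_neg hx')
      (hW.no_stagnation _ hz'.2)))
  -- the minimum is attained in the interior
  obtain ⟨z₁, hz₁, hwz₁⟩ : ∃ z₁ ∈ openRegion d (Ioo 0 Real.pi) η, P z₁ / Q z₁ = m := by
    rcases hm0.eq_or_lt with hm0 | hm0
    · exact ⟨z, hint z hzD hx hy hwz, le_antisymm (hm0 ▸ hwz) (hle z hzD)⟩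
    · have hP0 : P z₀ ≠ 0 := fun h => by rw [hm, h, zero_div] at hm0; exact lt_irrefl _ hm0
      obtain ⟨x₀, y₀⟩ := z₀
      refine ⟨(x₀, y₀), hint _ hz₀ ⟨lt_of_le_of_ne hz₀.1.1 ?_, lt_of_le_of_ne hz₀.1.2 ?_⟩ ?_ hm0.le,
        rfl⟩
      · rintro rfl; exact hP0 (hW.partialX_crest hz₀.2)
      · rintro h
        simp only at h
        subst h
        exact hP0 (hW.partialX_trough hz₀.2)
      · rintro h
        simp only at h
        subst h
        exact hP0 (hW.partialX_bed x₀)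
  have hU : openRegion d (Ioo 0 Real.pi) η ⊆ closedRegion d (Icc 0 Real.pi) η :=
    fun w hw => ⟨Ioo_subset_Icc_self hw.1, hw.2.1.le, hw.2.2.le⟩
  obtain ⟨K, hK⟩ := hW.exists_deriv_vorticity_le
  have hpos : ∀ w ∈ openRegion d (Ioo 0 Real.pi) η, 0 ≤ m * Q w - P w := fun w hw => by
    have h1 := (le_div_iff_of_neg (hW.no_stagnation w (hsub (hU hw)))).1 (hle w (hU hw))
    exact sub_nonneg.2 h1
  have hzero := hW.eq_zero_of_nonneg (f := fun w => m * Q w - P w)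
    (isOpen_openRegion hηc isOpen_Ioo)
    (isPreconnected_openRegion hηc hW.surface_above_bed isPreconnected_Ioo)
    (fun w hw => hw.2) 0 0 (-1) m K (fun w => by ring) hpos
    (fun w hw => by
      have h1 := hpos w hw
      have h2 := (abs_le.1 (hK w (hsub (hU hw)))).1
      nlinarith) hz₁
    (by
      rw [← hwz₁, div_mul_cancel₀ _ (hW.no_stagnation _ (hsub (hU hz₁))).ne, sub_self])
  have hsurf : m * Q (Real.pi / 2, η (Real.pi / 2)) - P (Real.pi / 2, η (Real.pi / 2)) = 0 :=
    eq_zero_of_eq_zero_openRegion (I := Ioo 0 Real.pi) (K := closedFluidDomain d η)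
    (z := (Real.pi / 2, η (Real.pi / 2)))
    ((hW.contDiffOn_partialY.continuousOn.const_mul m).sub hW.contDiffOn_partialX.continuousOn)
    hηc hW.surface_above_bed subset_closure (fun w hw => hsub (hU hw)) hzero
    ⟨pi_div_two_mem, hW.mem_surface _⟩ (hW.mem_surface _)
  have h1 := hW.partialX_surface_neg pi_div_two_mem
  have h2 := mul_nonneg_of_nonpos_of_nonpos hm0
    (hW.no_stagnation _ (hW.mem_surface (Real.pi / 2))).le
  simp only [← hP, ← hQ] at h1 h2
  linarith

lemma deriv_streamline_neg (hW : IsSteadyWave d g c C p₀ γ η ψ) (hσ : IsStreamline d η ψ p σ)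
    (hp : p₀ < p) {x : ℝ} (hx : x ∈ Ioo 0 Real.pi) : deriv σ x < 0 := by
  rw [hσ.deriv_eq hW]
  exact neg_neg_of_pos (div_pos_of_neg_of_neg
    (hW.partialX_neg (hσ.mem x) hx (hσ.bed_lt hW hp x).ne') (hW.no_stagnation _ (hσ.mem x)))

/-- The midpoint between the bed and the crest of a streamline lies strictly below the
streamline. -/
lemma crest_mem_openRegion (hW : IsSteadyWave d g c C p₀ γ η ψ) (hσ : IsStreamline d η ψ p σ)
    (hp : p₀ < p) : ((0, (-d + σ 0) / 2) : ℝ × ℝ) ∈ openRegion d univ σ := by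
  have := hσ.bed_lt hW hp 0
  refine ⟨mem_univ _, ?_, ?_⟩ <;> simp only <;> linarith

lemma openRegion_subset_fluidDomain {I : Set ℝ} (hσ : IsStreamline d η ψ p σ) :
    openRegion d I σ ⊆ fluidDomain d η :=
  fun z hz => ⟨hz.2.1, hz.2.2.trans_le (hσ.mem z.1).2⟩

lemma openRegion_subset_closedFluidDomain {I : Set ℝ} :
    openRegion d I σ ⊆ closedFluidDomain d σ :=
  fun _ hz => ⟨hz.2.1.le, hz.2.2.le⟩

/-- Below a streamline, the steepness `|ψ_x / ψ_y|` has no maximum: if it attained the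
maximum `m > 0`, then one of `±ψ_x - m ψ_y` would be a nonnegative solution of the linearised
equation with a zero, hence vanish, although `ψ_x = 0` on the crest line. -/
lemma slope_not_max (hW : IsSteadyWave d g c C p₀ γ η ψ) (hσ : IsStreamline d η ψ p σ)
    (hp : p₀ < p) {z : ℝ × ℝ} (hz : z ∈ closedFluidDomain d σ) (hzσ : z.2 < σ z.1)
    (hmax : ∀ z' ∈ closedFluidDomain d σ,
      |partialX (closedFluidDomain d η) ψ z' / partialY (closedFluidDomain d η) ψ z'|
        ≤ |partialX (closedFluidDomain d η) ψ z / partialY (closedFluidDomain d η) ψ z|) :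
    False := by
  set P := partialX (closedFluidDomain d η) ψ with hP
  set Q := partialY (closedFluidDomain d η) ψ with hQ
  set m := |P z / Q z| with hm
  have hsub : closedFluidDomain d σ ⊆ closedFluidDomain d η :=
    closedFluidDomain_mono fun x => (hσ.mem x).2
  have hmpos : 0 < m := by
    have hmem : (Real.pi / 2, σ (Real.pi / 2)) ∈ closedFluidDomain d σ := ⟨(hσ.mem _).1, le_rfl⟩
    refine lt_of_lt_of_le (abs_pos.2 (div_ne_zero ?_ ?_)) (hmax _ hmem)
    · exact (hW.partialX_neg (hσ.mem _) pi_div_two_mem (hσ.bed_lt hW hp _).ne').ne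
    · exact (hW.no_stagnation _ (hσ.mem _)).ne
  have hzU : z ∈ openRegion d univ σ := by
    refine ⟨mem_univ _, lt_of_le_of_ne hz.1 fun h => hmpos.ne' ?_, hzσ⟩
    have hz' : z = (z.1, -d) := Prod.ext rfl h.symm
    have : P z = 0 := by rw [hz']; exact hW.partialX_bed z.1
    rw [hm, this]; simp
  obtain ⟨s, hs, hsz⟩ : ∃ s : ℝ, |s| = 1 ∧ s * (P z / Q z) = m := by
    rcases abs_choice (P z / Q z) with h | h
    · exact ⟨1, by simp, by rw [hm, h, one_mul]⟩
    · exact ⟨-1, by simp, by rw [hm, h, neg_one_mul]⟩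
  obtain ⟨K, hK⟩ := hW.exists_deriv_vorticity_le
  have hpos : ∀ w ∈ openRegion d univ σ, 0 ≤ s * P w - m * Q w := fun w hw => by
    have hw' := openRegion_subset_closedFluidDomain hw
    have h1 : s * P w / Q w ≤ m := by
      refine le_trans (le_abs_self _) ?_
      rw [mul_div_assoc, abs_mul, hs, one_mul]
      exact hmax w hw'
    exact sub_nonneg.2 ((div_le_iff_of_neg (hW.no_stagnation w (hsub hw'))).1 h1)
  have hσc := (hσ.differentiable hW).continuous
  have hzero := hW.eq_zero_of_nonneg (f := fun w => s * P w - m * Q w)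
    (isOpen_openRegion hσc isOpen_univ)
    (isPreconnected_openRegion hσc (hσ.bed_lt hW hp) isPreconnected_univ)
    (openRegion_subset_fluidDomain hσ) 0 0 s (-m) K (fun w => by ring) hpos
    (fun w hw => by
      have h1 := hpos w hw
      have h2 := (abs_le.1 (hK w (hsub (openRegion_subset_closedFluidDomain hw)))).1
      nlinarith) hzU
    (by
      rw [← hsz, mul_assoc, div_mul_cancel₀ _ (hW.no_stagnation _ (hsub hz)).ne, sub_self])
  have hcr := hW.crest_mem_openRegion hσ hp
  have hcr' := hsub (openRegion_subset_closedFluidDomain hcr)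
  have h1 := hzero _ hcr
  have h2 : P (0, (-d + σ 0) / 2) = 0 := hW.partialX_crest hcr'
  simp only [h2, mul_zero, zero_sub, neg_eq_zero, mul_eq_zero] at h1
  rcases h1 with h1 | h1
  · exact hmpos.ne' h1
  · exact (hW.no_stagnation _ hcr').ne h1

/-- If `γ' ≤ 0`, then `|ψ_x|` has no maximum below a streamline: `ψ_x ≤ 0` is superharmonic on the
half period `0 < x < π`, and vanishes on the crest line. -/
lemma abs_partialX_not_max (hW : IsSteadyWave d g c C p₀ γ η ψ) (hσ : IsStreamline d η ψ p σ)
    (hp : p₀ < p) (hγ : ∀ s ∈ Icc 0 (-p₀), derivWithin γ (Icc 0 (-p₀)) s ≤ 0)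
    {z : ℝ × ℝ} (hz : z ∈ closedFluidDomain d σ) (hzσ : z.2 < σ z.1)
    (hmax : ∀ z' ∈ closedFluidDomain d σ,
      |partialX (closedFluidDomain d η) ψ z'| ≤ |partialX (closedFluidDomain d η) ψ z|) :
    False := by
  set P := partialX (closedFluidDomain d η) ψ with hP
  set m := |P z| with hm
  have hσc := (hσ.differentiable hW).continuous
  have hsub : closedFluidDomain d σ ⊆ closedFluidDomain d η :=
    closedFluidDomain_mono fun x => (hσ.mem x).2
  have hmpos : 0 < m := by
    have hmem : (Real.pi / 2, σ (Real.pi / 2)) ∈ closedFluidDomain d σ := ⟨(hσ.mem _).1, le_rfl⟩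
    refine lt_of_lt_of_le (abs_pos.2 ?_) (hmax _ hmem)
    exact (hW.partialX_neg (hσ.mem _) pi_div_two_mem (hσ.bed_lt hW hp _).ne').ne
  have hzd : -d < z.2 := by
    refine lt_of_le_of_ne hz.1 fun h => hmpos.ne' ?_
    have hz' : z = (z.1, -d) := Prod.ext rfl h.symm
    have : P z = 0 := by rw [hz']; exact hW.partialX_bed z.1
    rw [hm, this]; simp
  obtain ⟨⟨x', y'⟩, hz', hx', heq, hy1, hy2⟩ :=
    (hW.symmetricOn_abs_partialX.mono hsub).exists_mem_Icc (hσ.bed_lt hW hp) (hσ.periodic hW)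
      (hσ.even hW) hz
  simp only [← hP, ← hm] at heq hx' hy1 hy2
  have hP0 : P (x', y') ≠ 0 := abs_pos.1 (heq ▸ hmpos)
  have hx'' : x' ∈ Ioo 0 Real.pi := by
    refine ⟨lt_of_le_of_ne hx'.1 ?_, lt_of_le_of_ne hx'.2 ?_⟩
    · rintro rfl; exact hP0 (hW.partialX_crest (hsub hz'))
    · rintro rfl; exact hP0 (hW.partialX_trough (hsub hz'))
  have hneg : ∀ w ∈ openRegion d (Ioo 0 Real.pi) σ, P w < 0 := fun w hw =>
    hW.partialX_neg (hsub (openRegion_subset_closedFluidDomain hw)) hw.1 hw.2.1.ne'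
  have hzU : (x', y') ∈ openRegion d (Ioo 0 Real.pi) σ := ⟨hx'', hy1 hzd, hy2 hzσ⟩
  have hzero := hW.eq_zero_of_nonneg (f := fun w => m + P w)
    (isOpen_openRegion hσc isOpen_Ioo)
    (isPreconnected_openRegion hσc (hσ.bed_lt hW hp) isPreconnected_Ioo)
    (openRegion_subset_fluidDomain hσ) m 0 1 0 0 (fun w => by ring)
    (fun w hw => by
      have := hmax w (openRegion_subset_closedFluidDomain hw)
      linarith [(abs_le.1 this).1])
    (fun w hw => by
      have h1 := hneg w hw
      have h2 := hγ _ (hW.stream_mem_Icc (hsub (openRegion_subset_closedFluidDomain hw)))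
      have h3 := mul_nonneg_of_nonpos_of_nonpos h2 h1.le
      simp only [one_mul, zero_mul, add_zero]
      linarith) hzU
    (by
      have := hneg _ hzU
      rw [← heq, abs_of_neg this]
      ring)
  have hcr := openRegion_subset_closedFluidDomain (hW.crest_mem_openRegion hσ hp)
  have hlim : m + P (0, (-d + σ 0) / 2) = 0 :=
    eq_zero_of_eq_zero_openRegion (I := Icc 0 Real.pi) (J := Ioo 0 Real.pi)
    (K := closedFluidDomain d η) (z := (0, (-d + σ 0) / 2))
    (continuousOn_const.add hW.contDiffOn_partialX.continuousOn)
    hσc (hσ.bed_lt hW hp) (by rw [closure_Ioo Real.pi_pos.ne])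
    (fun w hw => hsub (openRegion_subset_closedFluidDomain hw)) hzero
    ⟨⟨le_rfl, Real.pi_pos.le⟩, hcr⟩ (hsub hcr)
  have h0 : P (0, (-d + σ 0) / 2) = 0 := hW.partialX_crest (hsub hcr)
  rw [h0, add_zero] at hlim
  exact hmpos.ne' hlim

/-- `ψ_y` is not constant below a streamline: otherwise that streamline would be horizontal. -/
lemma partialY_not_const (hW : IsSteadyWave d g c C p₀ γ η ψ) (hσ : IsStreamline d η ψ p σ)
    (hp : p₀ < p) {M : ℝ}
    (hM : ∀ w ∈ openRegion d univ σ, partialY (closedFluidDomain d η) ψ w = M) : False := by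
  have hslope : ∀ x, M * (σ x + d) = p₀ - p := fun x => by
    have hlt := hσ.bed_lt hW hp x
    have hsub : Icc (-d) (σ x) ⊆ Icc (-d) (η x) := Icc_subset_Icc_right (hσ.mem x).2
    obtain ⟨ξ, hξ, heq⟩ := exists_hasDerivAt_eq_slope (fun y => ψ (x, y))
      (fun y => partialY (closedFluidDomain d η) ψ (x, y)) hlt
      (fun y hy => (hW.hasDerivWithinAt_vertical (hsub hy)).continuousWithinAt.mono hsub)
      (fun y hy => (hW.hasDerivWithinAt_vertical (hsub (Ioo_subset_Icc_self hy))).hasDerivAt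
        (Icc_mem_nhds hy.1 (hy.2.trans_le (hσ.mem x).2)))
    rw [hM (x, ξ) ⟨mem_univ _, hξ.1, hξ.2⟩, hσ.stream_eq, hW.stream_bed, eq_div_iff (by linarith)]
      at heq
    linarith
  have hM0 : M ≠ 0 := fun h => by
    have := hslope 0
    rw [h, zero_mul] at this
    linarith
  have hconst : σ = fun _ => (p₀ - p) / M - d := funext fun x => by
    rw [← hslope x]; field_simp; ring
  have := hW.deriv_streamline_neg hσ hp pi_div_two_mem
  rw [hconst] at this
  simp at this

/-- If `γ' ≥ 0`, then `ψ_y < 0` is subharmonic, and has no maximum strictly between the bed and a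
streamline. -/
lemma partialY_not_max_interior (hW : IsSteadyWave d g c C p₀ γ η ψ)
    (hσ : IsStreamline d η ψ p σ) (hp : p₀ < p)
    (hγ : ∀ s ∈ Icc 0 (-p₀), 0 ≤ derivWithin γ (Icc 0 (-p₀)) s)
    {z : ℝ × ℝ} (hz : z ∈ openRegion d univ σ)
    (hmax : ∀ z' ∈ closedFluidDomain d σ,
      partialY (closedFluidDomain d η) ψ z' ≤ partialY (closedFluidDomain d η) ψ z) : False := by
  set Q := partialY (closedFluidDomain d η) ψ with hQ
  have hσc := (hσ.differentiable hW).continuous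
  have hzero := hW.eq_zero_of_nonneg (f := fun w => Q z - Q w)
    (isOpen_openRegion hσc isOpen_univ)
    (isPreconnected_openRegion hσc (hσ.bed_lt hW hp) isPreconnected_univ)
    (openRegion_subset_fluidDomain hσ) (Q z) 0 0 (-1) 0 (fun w => by ring)
    (fun w hw => sub_nonneg.2 (hmax w (openRegion_subset_closedFluidDomain hw)))
    (fun w hw => by
      have hw' := fluidDomain_subset d η (openRegion_subset_fluidDomain hσ hw)
      have h3 := mul_nonpos_of_nonneg_of_nonpos (hγ _ (hW.stream_mem_Icc hw'))
        (hW.no_stagnation w hw').le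
      simp only [zero_mul, zero_add, ← hQ] at h3 ⊢
      linarith) hz (sub_self _)
  exact hW.partialY_not_const hσ hp fun w hw => (sub_eq_zero.1 (hzero w hw)).symm

lemma hasDerivAt_partialY_vertical (hW : IsSteadyWave d g c C p₀ γ η ψ) {x y : ℝ}
    (hz : (x, y) ∈ fluidDomain d η) :
    HasDerivAt (fun y => partialY (closedFluidDomain d η) ψ (x, y))
      (fderiv ℝ (partialY (closedFluidDomain d η) ψ) (x, y) (0, 1)) y := by
  have h1 : HasFDerivAt (partialY (closedFluidDomain d η) ψ) _ (x, y) :=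
    ((hW.contDiffOn_partialY.contDiffAt (hW.closed_mem_nhds hz)).differentiableAt
      one_ne_zero).hasFDerivAt
  exact h1.comp_hasDerivAt y ((hasDerivAt_const y x).prodMk (hasDerivAt_id y))

/-- `ψ_xx` vanishes on the bed. -/
lemma fderivWithin_partialX_bed (hW : IsSteadyWave d g c C p₀ γ η ψ) (x : ℝ) :
    fderivWithin ℝ (partialX (closedFluidDomain d η) ψ) (closedFluidDomain d η) (x, -d) (1, 0)
      = 0 := by
  have h1 := (hW.contDiffOn_partialX.differentiableOn one_ne_zero _
    (hW.mem_bed x)).hasFDerivWithinAt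
  have h2 := h1.comp_hasDerivWithinAt (s := univ) x
    ((hasDerivWithinAt_id x univ).prodMk (hasDerivWithinAt_const x univ (-d)))
    fun t _ => hW.mem_bed t
  rw [hasDerivWithinAt_univ] at h2
  refine h2.unique ((hasDerivAt_const x (0 : ℝ)).congr_of_eventuallyEq ?_)
  exact Eventually.of_forall fun t => hW.partialX_bed t

/-- A boundary point lemma of Hopf type: a maximum of the subharmonic function `ψ_y` on the bed
forces `ψ_y` to decrease at least linearly away from the bed. The barrier is a linear function
of `y`, which suffices because the bed is flat and everything is periodic. -/
lemma exists_partialY_le_of_max_bed (hW : IsSteadyWave d g c C p₀ γ η ψ)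
    (hσ : IsStreamline d η ψ p σ) (hp : p₀ < p)
    (hγ : ∀ s ∈ Icc 0 (-p₀), 0 ≤ derivWithin γ (Icc 0 (-p₀)) s) {x₀ : ℝ}
    (hmax : ∀ z' ∈ closedFluidDomain d σ,
      partialY (closedFluidDomain d η) ψ z' ≤ partialY (closedFluidDomain d η) ψ (x₀, -d)) :
    ∃ ε > 0, ∃ h, -d < h ∧ h ≤ σ x₀ ∧ ∀ y ∈ Icc (-d) h, partialY (closedFluidDomain d η) ψ (x₀, y)
      ≤ partialY (closedFluidDomain d η) ψ (x₀, -d) - ε * (y + d) := by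
  set Q := partialY (closedFluidDomain d η) ψ with hQ
  set M := Q (x₀, -d) with hM
  have hσc := (hσ.differentiable hW).continuous
  obtain ⟨x₁, -, hx₁⟩ := isCompact_Icc.exists_isMinOn (nonempty_Icc.2 Real.pi_pos.le)
    hσc.continuousOn
  have hσ₁ : ∀ x, σ x₁ ≤ σ x := fun x => by
    obtain ⟨x', hx', heq⟩ := exists_mem_Icc_zero_pi (hσ.periodic hW) (hσ.even hW) x
    rw [← heq]; exact hx₁ hx'
  -- a horizontal strip above the bed that stays below the streamline
  obtain ⟨h, hdh, hhσ⟩ : ∃ h, -d < h ∧ ∀ x, h < σ x :=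
    ⟨(-d + σ x₁) / 2, by linarith [hσ.bed_lt hW hp x₁],
      fun x => by linarith [hσ.bed_lt hW hp x₁, hσ₁ x]⟩
  have hstrip : closedFluidDomain d (fun _ => h) ⊆ closedFluidDomain d σ :=
    closedFluidDomain_mono fun x => (hhσ x).le
  have hsub : closedFluidDomain d σ ⊆ closedFluidDomain d η :=
    closedFluidDomain_mono fun x => (hσ.mem x).2
  have htop : ∀ x, (x, h) ∈ openRegion d univ σ := fun x => ⟨mem_univ _, hdh, hhσ x⟩
  -- the maximum over the top of the strip is smaller than `M`
  obtain ⟨ε, hε, hεtop⟩ : ∃ ε > 0, ∀ x, Q (x, h) + ε * (h + d) ≤ M := by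
    have hcont : Continuous fun x => Q (x, h) :=
      hW.contDiffOn_partialY.continuousOn.comp_continuous (by fun_prop)
        fun x => hsub (openRegion_subset_closedFluidDomain (htop x))
    obtain ⟨x₂, -, hx₂⟩ := isCompact_Icc.exists_isMaxOn (nonempty_Icc.2 Real.pi_pos.le)
      hcont.continuousOn
    have hlt : Q (x₂, h) < M := by
      by_contra hge
      push Not at hge
      exact hW.partialY_not_max_interior hσ hp hγ (htop x₂)
        fun z' hz' => (hmax z' hz').trans hge
    have hdh' : 0 < h + d := by linarith
    refine ⟨(M - Q (x₂, h)) / (h + d), div_pos (by linarith) hdh', fun x => ?_⟩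
    obtain ⟨x', hx', heq⟩ := exists_mem_Icc_zero_pi (h := fun x => Q (x, h))
      (fun x => hW.partialY_translate (hsub (openRegion_subset_closedFluidDomain (htop x))))
      (fun x => hW.partialY_reflect (hsub (openRegion_subset_closedFluidDomain (htop x)))) x
    have h1 : Q (x', h) ≤ Q (x₂, h) := hx₂ hx'
    rw [div_mul_cancel₀ _ hdh'.ne']
    linarith
  refine ⟨ε, hε, h, hdh, (hhσ x₀).le, ?_⟩
  have hsymm : SymmetricOn (closedFluidDomain d fun _ => h) fun w => Q w + ε * (w.2 + d) :=
    ⟨fun x y hz => by rw [hQ, hW.partialY_translate (hsub (hstrip hz))],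
      fun x y hz => by rw [hQ, hW.partialY_reflect (hsub (hstrip hz))]⟩
  have hqc : ContinuousOn (fun w => Q w + ε * (w.2 + d)) (closedFluidDomain d η) :=
    hW.contDiffOn_partialY.continuousOn.add (by fun_prop)
  obtain ⟨z, hz, hzmax⟩ := hsymm.exists_isMaxOn (hqc.mono (hstrip.trans hsub)) continuous_const
    (fun _ => hdh) (fun _ => rfl) (fun _ => rfl)
  have hbed : (x₀, -d) ∈ closedFluidDomain d fun _ => h := ⟨le_rfl, hdh.le⟩
  suffices hle : Q z + ε * (z.2 + d) ≤ M by
    intro y hy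
    have := (hzmax (x₀, y) hy).trans hle
    simp only at this
    linarith
  by_contra hcon
  push Not at hcon
  have hzU : z ∈ openRegion d univ fun _ => h := by
    refine ⟨mem_univ _, lt_of_le_of_ne hz.1 fun heq => ?_, lt_of_le_of_ne hz.2 fun heq => ?_⟩
    · have h1 := hmax z (hstrip hz)
      rw [← heq] at hcon
      linarith
    · have h1 := hεtop z.1
      simp only at heq
      rw [← heq] at h1
      exact absurd hcon (not_lt.2 h1)
  have hUsub : (openRegion d univ fun _ => h) ⊆ fluidDomain d η := fun w hw =>
    ⟨hw.2.1, hw.2.2.trans ((hhσ w.1).trans_le (hσ.mem w.1).2)⟩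
  have hzero := hW.eq_zero_of_nonneg
    (f := fun w => Q z + ε * (z.2 + d) - (Q w + ε * (w.2 + d)))
    (isOpen_openRegion continuous_const isOpen_univ)
    (isPreconnected_openRegion continuous_const (fun _ => hdh) isPreconnected_univ)
    hUsub (Q z + ε * z.2) (-ε) 0 (-1) 0 (fun w => by ring)
    (fun w hw => sub_nonneg.2 (hzmax w (openRegion_subset_closedFluidDomain hw)))
    (fun w hw => by
      have hw' := fluidDomain_subset d η (hUsub hw)
      have h3 := mul_nonpos_of_nonneg_of_nonpos (hγ _ (hW.stream_mem_Icc hw'))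
        (hW.no_stagnation w hw').le
      simp only [zero_mul, zero_add, ← hQ] at h3 ⊢
      linarith) hzU (sub_self _)
  have hlim : Q z + ε * (z.2 + d) - (M + ε * (-d + d)) = 0 :=
    eq_zero_of_eq_zero_openRegion (I := univ) (J := univ) (z := (x₀, -d))
    (continuousOn_const.sub hqc) continuous_const (fun _ => hdh) subset_closure
    (hUsub.trans (fluidDomain_subset d η)) hzero ⟨mem_univ _, hbed⟩ (hW.mem_bed x₀)
  rw [neg_add_cancel, mul_zero, add_zero] at hlim
  linarith

/-- If `γ' ≥ 0` and `γ ≤ 0`, then `ψ_y` has no maximum below a streamline. On the bed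
`ψ_yy = -γ ≥ 0`, which excludes a maximum there. -/
lemma partialY_not_max (hW : IsSteadyWave d g c C p₀ γ η ψ) (hσ : IsStreamline d η ψ p σ)
    (hp : p₀ < p) (hγ : ∀ s ∈ Icc 0 (-p₀), 0 ≤ derivWithin γ (Icc 0 (-p₀)) s)
    (hγ' : ∀ s ∈ Icc 0 (-p₀), γ s ≤ 0)
    {z : ℝ × ℝ} (hz : z ∈ closedFluidDomain d σ) (hzσ : z.2 < σ z.1)
    (hmax : ∀ z' ∈ closedFluidDomain d σ,
      partialY (closedFluidDomain d η) ψ z' ≤ partialY (closedFluidDomain d η) ψ z) : False := by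
  rcases hz.1.lt_or_eq with hzd | hzd
  · exact hW.partialY_not_max_interior hσ hp hγ ⟨mem_univ _, hzd, hzσ⟩ hmax
  obtain ⟨x₀, y₀⟩ := z
  simp only at hzd hzσ
  subst hzd
  obtain ⟨ε, hε, h, hdh, hhσ, hle⟩ := hW.exists_partialY_le_of_max_bed hσ hp hγ hmax
  have hhη : h ≤ η x₀ := hhσ.trans (hσ.mem x₀).2
  -- close to the bed `ψ_xx` is smaller than `ε`
  have hcont : ContinuousWithinAt (fun y => fderivWithin ℝ (partialX (closedFluidDomain d η) ψ)
      (closedFluidDomain d η) (x₀, y) (1, 0)) (Icc (-d) h) (-d) := by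
    have h1 : ContinuousOn (fun w => fderivWithin ℝ (partialX (closedFluidDomain d η) ψ)
        (closedFluidDomain d η) w (1, 0)) (closedFluidDomain d η) :=
      (hW.contDiffOn_partialX.continuousOn_fderivWithin hW.uniqueDiffOn le_rfl).clm_apply
        continuousOn_const
    exact (h1.comp (f := fun y => (x₀, y)) (by fun_prop)
      fun y hy => ⟨hy.1, hy.2.trans hhη⟩) (-d) (left_mem_Icc.2 hdh.le)
  have hsmall : ∀ᶠ y in 𝓝[Icc (-d) h] (-d), fderivWithin ℝ (partialX (closedFluidDomain d η) ψ)
      (closedFluidDomain d η) (x₀, y) (1, 0) < ε :=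
    hcont.eventually_lt_const ((hW.fderivWithin_partialX_bed x₀).trans_lt hε)
  obtain ⟨δ, hδ, hball⟩ := Metric.mem_nhdsWithin_iff.1 hsmall
  obtain ⟨y, hy, hyδ, hyh⟩ : ∃ y, -d < y ∧ y < -d + δ ∧ y < h :=
    ⟨-d + min δ (h + d) / 2, by
      have : 0 < min δ (h + d) := lt_min hδ (by linarith)
      linarith, by
      have := min_le_left δ (h + d)
      linarith, by
      have := min_le_right δ (h + d)
      linarith⟩
  have hmem : ∀ ξ ∈ Ioo (-d) y, (x₀, ξ) ∈ fluidDomain d η := fun ξ hξ =>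
    ⟨hξ.1, (hξ.2.trans hyh).trans_le hhη⟩
  obtain ⟨ξ, hξ, heq⟩ := exists_hasDerivAt_eq_slope
    (fun y => partialY (closedFluidDomain d η) ψ (x₀, y))
    (fun y => fderiv ℝ (partialY (closedFluidDomain d η) ψ) (x₀, y) (0, 1)) hy
    (hW.contDiffOn_partialY.continuousOn.comp (by fun_prop)
      fun t ht => ⟨ht.1, (ht.2.trans hyh.le).trans hhη⟩)
    (fun t ht => hW.hasDerivAt_partialY_vertical (hmem t ht))
  have hξΩ := hmem ξ hξ
  have h1 := hle y ⟨hy.le, hyh.le⟩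
  have h2 := hW.fderiv_partialX_add_fderiv_partialY hξΩ
  have h3 := hγ' _ (hW.stream_mem_Icc (fluidDomain_subset d η hξΩ))
  have h4 : fderivWithin ℝ (partialX (closedFluidDomain d η) ψ)
      (closedFluidDomain d η) (x₀, ξ) (1, 0) < ε := by
    refine hball ⟨?_, hξ.1.le, (hξ.2.trans hyh).le⟩
    rw [Metric.mem_ball, Real.dist_eq, abs_lt]
    constructor <;> linarith [hξ.1, hξ.2]
  rw [fderivWithin_of_mem_nhds (hW.closed_mem_nhds hξΩ)] at h4
  rw [eq_div_iff (by linarith)] at heq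
  have h5 : fderiv ℝ (partialY (closedFluidDomain d η) ψ) (x₀, ξ) (0, 1) > -ε := by linarith
  have h6 : 0 < y - -d := by linarith
  nlinarith

end IsSteadyWave

theorem lemma1 (d g c C p₀ : ℝ) (γ η : ℝ → ℝ) (ψ : ℝ × ℝ → ℝ)
    (hW : IsSteadyWave d g c C p₀ γ η ψ) :
    -- the streamlines are the differentiable graphs indexed by `p ∈ [p₀, 0]`, `p₀ < 0`,
    -- ordered from the bed to the surface
    (p₀ < 0 ∧
      IsStreamline d η ψ p₀ (fun _ => -d) ∧ IsStreamline d η ψ 0 η ∧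
      (∀ p ∈ Set.Icc p₀ 0, ∃! σ : ℝ → ℝ, IsStreamline d η ψ p σ) ∧
      (∀ (p : ℝ) (σ : ℝ → ℝ), IsStreamline d η ψ p σ →
        p ∈ Set.Icc p₀ 0 ∧ Differentiable ℝ σ) ∧
      (∀ (p₁ p₂ : ℝ) (σ₁ σ₂ : ℝ → ℝ), IsStreamline d η ψ p₁ σ₁ → IsStreamline d η ψ p₂ σ₂ →
        p₁ < p₂ → ∀ x, σ₁ x < σ₂ x)) ∧
    -- (i)
    ((∀ (p : ℝ) (σ : ℝ → ℝ), IsStreamline d η ψ p σ → p ≠ p₀ →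
        ∀ x ∈ Set.Ioo 0 Real.pi, deriv σ x < 0) ∧
      MaxStrictlyIncreasesUpwards d p₀ η ψ (fun σ x => |deriv σ x|)) ∧
    -- (ii)
    ((∀ s ∈ Set.Icc 0 (-p₀), 0 ≤ derivWithin γ (Set.Icc 0 (-p₀)) s) →
      (∀ s ∈ Set.Icc 0 (-p₀), γ s ≤ 0) →
      MaxStrictlyIncreasesUpwards d p₀ η ψ
        (fun σ x => horizontalVelocity d c η ψ (x, σ x))) ∧
    -- (iii)
    ((∀ z ∈ closedFluidDomain d η, z.1 ∈ Set.Ioo 0 Real.pi → z.2 ≠ -d →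
        0 < verticalVelocity d η ψ z) ∧
      ((∀ s ∈ Set.Icc 0 (-p₀), derivWithin γ (Set.Icc 0 (-p₀)) s ≤ 0) →
        MaxStrictlyIncreasesUpwards d p₀ η ψ
          (fun σ x => |verticalVelocity d η ψ (x, σ x)|))) := by
  refine ⟨⟨hW.flux_neg, IsStreamline.bed hW, IsStreamline.surface hW, fun p hp => ?_,
    fun p σ hσ => ⟨hσ.mem_Icc hW, hσ.differentiable hW⟩,
    fun p₁ p₂ σ₁ σ₂ h₁ h₂ hp => h₁.lt_of_lt hW h₂ hp⟩, ⟨?_, ?_⟩, ?_, ?_, ?_⟩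
  · obtain ⟨σ, hσ⟩ := IsStreamline.exists_of_mem_Icc hW hp
    exact ⟨σ, hσ, fun σ' hσ' => hσ'.unique hσ⟩
  · exact fun p σ hσ hp x hx =>
      hW.deriv_streamline_neg hσ (lt_of_le_of_ne (hσ.mem_Icc hW).1 hp.symm) hx
  · exact maxStrictlyIncreasesUpwards_of_maximum_principle hW
      (fun p σ hσ x => by rw [hσ.deriv_eq hW, abs_neg])
      hW.continuousOn_slope.abs hW.symmetricOn_abs_slope
      fun p σ hσ hp z hz hzσ hmax => hW.slope_not_max hσ hp hz hzσ hmax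
  · intro hγ hγ'
    refine maxStrictlyIncreasesUpwards_of_maximum_principle hW
      (q := horizontalVelocity d c η ψ) (fun p σ hσ x => rfl)
      (continuousOn_const.add hW.contDiffOn_partialY.continuousOn)
      ⟨fun x y hz => congrArg (c + ·) (hW.symmetricOn_partialY.periodic x y hz),
        fun x y hz => congrArg (c + ·) (hW.symmetricOn_partialY.even x y hz)⟩
      fun p σ hσ hp z hz hzσ hmax => ?_
    exact hW.partialY_not_max hσ hp hγ hγ' hz hzσ fun z' hz' =>
      (add_le_add_iff_left c).1 (hmax z' hz')
  · exact fun z hz hx hy => neg_pos.2 (hW.partialX_neg hz hx hy)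
  · intro hγ
    exact maxStrictlyIncreasesUpwards_of_maximum_principle hW
      (fun p σ hσ x => by rw [verticalVelocity, abs_neg])
      hW.contDiffOn_partialX.continuousOn.abs hW.symmetricOn_abs_partialX
      fun p σ hσ hp z hz hzσ hmax => hW.abs_partialX_not_max hσ hp hγ hz hzσ hmax
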